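/- Let $d\ge 1$. Let $\Gamma_0$ be the space of finite subsets of $\mathbb R^d$ with its usual Borel $\sigma$-algebra (that of the disjoint union over $n$ of the quotients of $\{(x_1,\dots,x_n)\in(\mathbb R^d)^n: x_i\ne x_j,\ i\neq j\}$ by the symmetric group), $\Gamma_0^2:=\{(\eta^+,\eta^-)\in\Gamma_0\times\Gamma_0:\eta^+\cap\eta^-=\emptyset\}$, $\lambda:=\sum_{n\ge 0}\frac1{n!}m^{(n)}$ the Lebesgue–Poisson measure on $\Gamma_0$ ($m^{(n)}$ is the image of $dx_1\cdots dx_n$ under $(x_1,\dots,x_n)\mapsto\{x_1,\dots,x_n\}$, $m^{(0)}(\{\emptyset\})=1$), and $\lambda^2:=\lambda\otimes\lambda$ on $\Gamma_0^2$. We write $\eta=(\eta^+,\eta^-)$, $|\eta|:=|\eta^+|+|\eta^-|$, and $x$ for $\{x\}$. For bounded Borel $\Lambda\subset\mathbb R^d$ let $\Gamma_\Lambda^{(n,m)}:=\{\eta\in\Gamma_0^2:\eta^\pm\subset\Lambda,\ |\eta^+|=n,\ |\eta^-|=m\}$. For $F:\Gamma_0^2\to\mathbb R$ put $(\mathcal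 K^{-1}F)(\eta):=\sum_{\zeta^+\subset\eta^+,\,\zeta^-\subset\eta^-}(-1)^{|\eta^+\setminus\zeta^+|+|\eta^-\setminus\zeta^-|}F(\zeta^+,\zeta^-)$. For $C>0$ put $\|G\|_{\mathcal L_C}:=\int_{\Gamma_0^2}|G(\xi)|\,C^{|\xi|}\,d\lambda^2(\xi)$, and let $\mathcal K_C$ be the space of ($\lambda^2$-classes of) functions $k:\Gamma_0^2\to\mathbb R$ with $k\,C^{-|\cdot|}\in L^\infty(\Gamma_0^2,\lambda^2)$. For $i=1,2$ let $c_i^\pm:\mathbb R^d\times\mathbb R^d\times\Gamma_0^2\to[0,\infty)$ be measurable with $c_i^\pm(\cdot,\cdot,\eta)\in L^1_{\mathrm{loc}}(\mathbb R^d\times\mathbb R^d)$ for each $\eta\in\Gamma_0^2$, and put $$C_i^\pm(x,y,\xi^+,\xi^-,\eta^+,\eta^-):=\bigl(\mathcal K^{-1}c_i^\pm(x,y,\cdot\cup\xi^+,\cdot\cup\xi^-)\bigr)(\eta^+,\eta^-).$$ Fix $C>0$ and suppose that for $i=1,2$ there is $N_i:\Gamma_0^2\to\mathbb R$ with $\int_{\Gamma_\Lambda^{(n,m)}}N_i\,d\lambda^2<\infty$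 for all $n,m\in\mathbb N$ and all bounded Borel $\Lambda$, such that for $\lambda^2$-a.a. $\eta\in\Gamma_0^2$ $$\sum_{x\in\eta^+}\Bigl(\Bigl\|\int dy\,C_1^+(x,y,\eta^+\setminus x,\eta^-,\cdot,\cdot)\Bigr\|_{\mathcal L_C}+\int dy\,\bigl\|C_1^+(y,x,\eta^+\setminus x,\eta^-,\cdot,\cdot)\bigr\|_{\mathcal L_C}\Bigr)$$ $$+\sum_{y\in\eta^-}\Bigl(\int dx\,\bigl\|C_1^-(x,y,\eta^+,\eta^-\setminus y,\cdot,\cdot)\bigr\|_{\mathcal L_C}+\Bigl\|\int dx\,C_1^-(y,x,\eta^+,\eta^-\setminus y,\cdot,\cdot)\Bigr\|_{\mathcal L_C}\Bigr)\le N_1(\eta)$$ and $$\sum_{x\in\eta^+}\Bigl(\Bigl\|\int dy\,C_2^+(x,y,\eta^+\setminus x,\eta^-,\cdot,\cdot)\Bigr\|_{\mathcal L_C}+\int dy\,\bigl\|C_2^-(x,y,\eta^+\setminus x,\eta^-,\cdot,\cdot)\bigr\|_{\mathcal L_C}\Bigr)$$ $$+\sum_{y\in\eta^-}\Bigl(\int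 dx\,\bigl\|C_2^+(x,y,\eta^+,\eta^-\setminus y,\cdot,\cdot)\bigr\|_{\mathcal L_C}+\Bigl\|\int dx\,C_2^-(x,y,\eta^+,\eta^-\setminus y,\cdot,\cdot)\Bigr\|_{\mathcal L_C}\Bigr)\le N_2(\eta),$$ where a bound on a term $\|\int dy\,\cdots\|_{\mathcal L_C}$ includes that the integral exists for $\lambda^2$-a.a. values of the suppressed arguments. Suppose moreover that there are constants $A>0$, $M\in\mathbb N$, $\nu\ge1$ with $$N_i(\eta)\le A(1+|\eta|)^M\nu^{|\eta|},\qquad \eta\in\Gamma_0^2,\ i=1,2.$$ Then for every $\alpha\in(0,\frac1\nu)$ one has $\mathcal K_{\alpha C}\subset\mathcal K_C$, and the formulas $$\begin{aligned}(\hat L_1^*k)(\eta)=&\sum_{x\in\eta^+}\int d\lambda^2(\xi)\int dx'\,k((\xi^+\cup\eta^+\cup x')\setminus x,\xi^-\cup\eta^-)\,C_1^+(x',x,\eta^+\setminus x,\eta^-,\xi^+,\xi^-)\\&-\sum_{x\in\eta^+}\int d\lambda^2(\xi)\,k(\xi^+\cup\eta^+,\xi^-\cup\eta^-)\int dx'\,C_1^+(x,x',\eta^+\setminus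 x,\eta^-,\xi^+,\xi^-)\\&+\sum_{y\in\eta^-}\int d\lambda^2(\xi)\int dy'\,k(\xi^+\cup\eta^+,(\xi^-\cup\eta^-\cup y')\setminus y)\,C_1^-(y',y,\eta^+,\eta^-\setminus y,\xi^+,\xi^-)\\&-\sum_{y\in\eta^-}\int d\lambda^2(\xi)\,k(\xi^+\cup\eta^+,\xi^-\cup\eta^-)\int dy'\,C_1^-(y,y',\eta^+,\eta^-\setminus y,\xi^+,\xi^-)\end{aligned}$$ and $$\begin{aligned}(\hat L_2^*k)(\eta)=&\sum_{y\in\eta^-}\int d\lambda^2(\xi)\int dx\,k(\xi^+\cup\eta^+\cup x,(\xi^-\cup\eta^-)\setminus y)\,C_2^+(x,y,\eta^+,\eta^-\setminus y,\xi^+,\xi^-)\\&-\sum_{x\in\eta^+}\int d\lambda^2(\xi)\,k(\xi^+\cup\eta^+,\xi^-\cup\eta^-)\int dy\,C_2^+(x,y,\eta^+\setminus x,\eta^-,\xi^+,\xi^-)\\&+\sum_{x\in\eta^+}\int d\lambda^2(\xi)\int dy\,k((\xi^+\cup\eta^+)\setminus x,\xi^-\cup\eta^-\cup y)\,C_2^-(x,y,\eta^+\setminus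 x,\eta^-,\xi^+,\xi^-)\\&-\sum_{y\in\eta^-}\int d\lambda^2(\xi)\int dx\,k(\xi^+\cup\eta^+,\xi^-\cup\eta^-)\,C_2^-(x,y,\eta^+,\eta^-\setminus y,\xi^+,\xi^-)\end{aligned}$$ define linear operators $\hat L_1^*$ and $\hat L_2^*$ in $\mathcal K_C$ with domain $\mathcal K_{\alpha C}$. In particular, for $k\in\mathcal K_{\alpha C}$ both right-hand sides are well-defined for $\lambda^2$-a.a. $\eta$, and, as elements of $\mathcal K_C$, they do not depend on the representative of $k$. -/

import Mathlib

open MeasureTheory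
open scoped ENNReal Nat Classical

noncomputable section

namespace Hopping

/-- The position space `ℝ^d`. -/
abbrev Site (d : ℕ) := EuclideanSpace ℝ (Fin d)

/-- The space `Γ₀` of finite configurations, i.e. of finite subsets of `ℝ^d`. A structure around
`Finset` is used because `Finset` carries in Mathlib another `σ`-algebra than the one below. -/
@[ext]
structure Conf (d : ℕ) where
  /-- The underlying finite set of points. -/
  points : Finset (Site d)

instance instUnionConf (d : ℕ) : Union (Conf d) := ⟨fun η ξ => ⟨η.points ∪ ξ.points⟩⟩

instance instSDiffConf (d : ℕ) : SDiff (Conf d) := ⟨fun η ξ => ⟨η.points \ ξ.points⟩⟩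

instance instSingletonConf (d : ℕ) : Singleton (Site d) (Conf d) := ⟨fun x => ⟨{x}⟩⟩

/-- The set of tuples of `n` pairwise distinct points. -/
def DistinctTuple (d n : ℕ) : Set (Fin n → Site d) := {x | Function.Injective x}

/-- The map `(x₁, …, xₙ) ↦ {x₁, …, xₙ}` from tuples of distinct points onto the
`n`-point configurations. -/
def toConf (d n : ℕ) (x : DistinctTuple d n) : Conf d :=
  ⟨Finset.univ.map ⟨x.1, x.2⟩⟩

/-- The `σ`-algebra on `Γ₀ = ⨆ₙ Γ⁽ⁿ⁾`: a set of configurations is measurable iff, for every `n`,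
its preimage in the space of tuples of `n` distinct points is Borel. As `Γ⁽ⁿ⁾` is the quotient of
that (Polish) space by the finite group `Sₙ`, this is the Borel `σ`-algebra of the disjoint union
of the quotient topologies. -/
instance instMeasurableSpaceConf (d : ℕ) : MeasurableSpace (Conf d) :=
  ⨅ n : ℕ, MeasurableSpace.map (toConf d n) inferInstance

/-- The Lebesgue--Poisson measure `λ = ∑ₙ (1 / n!) m⁽ⁿ⁾` on `Γ₀` (with `z = 1`), where `m⁽ⁿ⁾` is the
image on `Γ⁽ⁿ⁾` of Lebesgue measure `dx₁ … dxₙ` on tuples of distinct points. -/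
def lebesguePoisson (d : ℕ) : Measure (Conf d) :=
  Measure.sum fun n : ℕ =>
    ((n ! : ℕ) : ℝ≥0∞)⁻¹ •
      Measure.map (toConf d n) (Measure.comap Subtype.val (volume : Measure (Fin n → Site d)))

/-- Pairs `(η⁺, η⁻)` of finite configurations. Functions on `Γ₀²` are represented by functions
on all pairs, of which only the values on `Γ₀²` matter. -/
abbrev Pair (d : ℕ) := Conf d × Conf d

/-- `Γ₀²`: the pairs `(η⁺, η⁻)` of finite configurations with `η⁺ ∩ η⁻ = ∅`. -/
def Conf2 (d : ℕ) : Set (Pair d) := {η | Disjoint η.1.points η.2.points}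

/-- The measure `λ² = λ ⊗ λ` on `Γ₀²`. -/
def lambda2 (d : ℕ) : Measure (Pair d) :=
  ((lebesguePoisson d).prod (lebesguePoisson d)).restrict (Conf2 d)

/-- The total number of particles `|η⁺| + |η⁻|`. -/
def size {d : ℕ} (η : Pair d) : ℕ := η.1.points.card + η.2.points.card

/-- The set `Γ_Λ^{(n,m)}` of all `(η⁺, η⁻) ∈ Γ₀²` with `η⁺, η⁻ ⊆ Λ`, `|η⁺| = n`, `|η⁻| = m`. -/
def localConf {d : ℕ} (Λ : Set (Site d)) (n m : ℕ) : Set (Pair d) :=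
  {η | η ∈ Conf2 d ∧ (η.1.points : Set (Site d)) ⊆ Λ ∧ (η.2.points : Set (Site d)) ⊆ Λ ∧
    η.1.points.card = n ∧ η.2.points.card = m}

/-- The inverse of the two-component `K`-transform,
`(K⁻¹F)(η⁺, η⁻) = ∑_{ζ⁺ ⊆ η⁺} ∑_{ζ⁻ ⊆ η⁻} (-1)^{|η⁺ \ ζ⁺| + |η⁻ \ ζ⁻|} F(ζ⁺, ζ⁻)`. -/
def Kinv {d : ℕ} (F : Pair d → ℝ) (η : Pair d) : ℝ :=
  ∑ ζp ∈ η.1.points.powerset, ∑ ζm ∈ η.2.points.powerset,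
    (-1 : ℝ) ^ ((η.1.points \ ζp).card + (η.2.points \ ζm).card) * F (⟨ζp⟩, ⟨ζm⟩)

/-- A hopping rate: `c x y η` is a function of two positions and a pair of configurations. -/
abbrev Rate (d : ℕ) := Site d → Site d → Pair d → ℝ

/-- The standing assumptions on a rate `c`: (joint) measurability, non-negativity, and local
integrability in the two positions for every `(η⁺, η⁻) ∈ Γ₀²`. -/
structure IsRate {d : ℕ} (c : Rate d) : Prop where
  measurable : Measurable fun p : (Site d × Site d) × Pair d => c p.1.1 p.1.2 p.2
  nonneg : ∀ x y, ∀ η ∈ Conf2 d, 0 ≤ c x y η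
  locallyIntegrable : ∀ η ∈ Conf2 d,
    LocallyIntegrable (fun p : Site d × Site d => c p.1 p.2 η) volume

/-- `C(x, y, ξ⁺, ξ⁻, η⁺, η⁻) = (K⁻¹ c(x, y, · ∪ ξ⁺, · ∪ ξ⁻))(η⁺, η⁻)`. -/
def coeff {d : ℕ} (c : Rate d) (x y : Site d) (ξ η : Pair d) : ℝ :=
  Kinv (fun ζ => c x y (ζ.1 ∪ ξ.1, ζ.2 ∪ ξ.2)) η

/-- The configuration pair with the point `x` removed from the `+`-component. -/
def removePlus {d : ℕ} (η : Pair d) (x : Site d) : Pair d := (η.1 \ {x}, η.2)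

/-- The configuration pair with the point `y` removed from the `-`-component. -/
def removeMinus {d : ℕ} (η : Pair d) (y : Site d) : Pair d := (η.1, η.2 \ {y})

/-- The norm `‖G‖_{𝓛_C} = ∫ |G(ξ⁺, ξ⁻)| C^{|ξ⁺| + |ξ⁻|} dλ²(ξ⁺, ξ⁻)`, possibly infinite. -/
def normL {d : ℕ} (C : ℝ) (G : Pair d → ℝ) : ℝ≥0∞ :=
  ∫⁻ ξ, ‖G ξ‖ₑ * ENNReal.ofReal C ^ size ξ ∂(lambda2 d)

/-- `∫ dy ‖F(y, ·)‖_{𝓛_C}`. -/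
def integralOfNorm {d : ℕ} (C : ℝ) (F : Site d → Pair d → ℝ) : ℝ≥0∞ :=
  ∫⁻ y, normL C (F y)

/-- `‖∫ dy F(y, ·)‖_{𝓛_C}`; it is finite only if the integral over `y` exists for
`λ²`-a.a. arguments. -/
def normOfIntegral {d : ℕ} (C : ℝ) (F : Site d → Pair d → ℝ) : ℝ≥0∞ :=
  ∫⁻ ξ, (if Integrable (fun y => F y ξ) volume then ‖∫ y, F y ξ‖ₑ else ∞) *
    ENNReal.ofReal C ^ size ξ ∂(lambda2 d)

/-- The quantity that `N₁` has to dominate (rates `cp = c₁⁺`, `cm = c₁⁻`). -/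
def bound1 {d : ℕ} (C : ℝ) (cp cm : Rate d) (η : Pair d) : ℝ≥0∞ :=
  (∑ x ∈ η.1.points,
    (normOfIntegral C (fun y ξ => coeff cp x y (removePlus η x) ξ) +
      integralOfNorm C (fun y ξ => coeff cp y x (removePlus η x) ξ))) +
  ∑ y ∈ η.2.points,
    (integralOfNorm C (fun x ξ => coeff cm x y (removeMinus η y) ξ) +
      normOfIntegral C (fun x ξ => coeff cm y x (removeMinus η y) ξ))

/-- The quantity that `N₂` has to dominate (rates `cp = c₂⁺`, `cm = c₂⁻`). -/
def bound2 {d : ℕ} (C : ℝ) (cp cm : Rate d) (η : Pair d) : ℝ≥0∞ :=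
  (∑ x ∈ η.1.points,
    (normOfIntegral C (fun y ξ => coeff cp x y (removePlus η x) ξ) +
      integralOfNorm C (fun y ξ => coeff cm x y (removePlus η x) ξ))) +
  ∑ y ∈ η.2.points,
    (integralOfNorm C (fun x ξ => coeff cp x y (removeMinus η y) ξ) +
      normOfIntegral C (fun x ξ => coeff cm x y (removeMinus η y) ξ))

/-- `N` is integrable over every `Γ_Λ^{(n,m)}`, `n, m ≥ 1`, with `Λ` bounded and Borel. -/
def LocallyIntegrableN {d : ℕ} (N : Pair d → ℝ) : Prop :=
  ∀ Λ : Set (Site d), MeasurableSet Λ → Bornology.IsBounded Λ →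
    ∀ n m : ℕ, 1 ≤ n → 1 ≤ m → IntegrableOn N (localConf Λ n m) (lambda2 d)

/-- `N(η) ≤ A (1 + |η⁺| + |η⁻|)^M ν^{|η⁺| + |η⁻|}` on `Γ₀²`. -/
def GrowthBound {d : ℕ} (A : ℝ) (M : ℕ) (ν : ℝ) (N : Pair d → ℝ) : Prop :=
  ∀ η ∈ Conf2 d, N η ≤ A * (1 + (size η : ℝ)) ^ M * ν ^ size η

/-- The space `𝒦_C` of all (classes of) functions `k` on `Γ₀²` for which
`k · C^{-|·⁺| - |·⁻|}` belongs to `L^∞(Γ₀², λ²)`. -/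
def KSpace (d : ℕ) (C : ℝ) : Submodule ℝ (Pair d →ₘ[lambda2 d] ℝ) where
  carrier := {k | MemLp (fun η => k η * (C ^ size η)⁻¹) ∞ (lambda2 d)}
  zero_mem' := by
    refine (memLp_congr_ae ?_).2 (MemLp.zero (ε := ℝ))
    filter_upwards [AEEqFun.coeFn_zero (α := Pair d) (β := ℝ) (μ := lambda2 d)] with η h
    simp [h]
  add_mem' := by
    intro k l hk hl
    refine (memLp_congr_ae ?_).2 (MemLp.add hk hl)
    filter_upwards [AEEqFun.coeFn_add k l] with η h
    simp [h, add_mul]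
  smul_mem' := by
    intro a k hk
    refine (memLp_congr_ae ?_).2 (MemLp.const_smul hk a)
    filter_upwards [AEEqFun.coeFn_smul a k] with η h
    simp [h, mul_assoc]

/-- The iterated integral `∫ dλ²(ξ) ∫ dx F(ξ, x)` is well-defined. -/
def IteratedIntegrable {d : ℕ} (F : Pair d → Site d → ℝ) : Prop :=
  (∀ᵐ ξ ∂(lambda2 d), Integrable (F ξ) volume) ∧
    Integrable (fun ξ => ∫ x, F ξ x) (lambda2 d)

/-- The iterated integral `∫ dλ²(ξ) g(ξ) ∫ dx F(ξ, x)` is well-defined. -/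
def WeightedIntegrable {d : ℕ} (g : Pair d → ℝ) (F : Pair d → Site d → ℝ) : Prop :=
  (∀ᵐ ξ ∂(lambda2 d), Integrable (F ξ) volume) ∧
    Integrable (fun ξ => g ξ * ∫ x, F ξ x) (lambda2 d)

/-- The expression for `L̂₁* k` (rates `cp = c₁⁺`, `cm = c₁⁻`). -/
def dualL1 {d : ℕ} (cp cm : Rate d) (k : Pair d → ℝ) (η : Pair d) : ℝ :=
  (∑ x ∈ η.1.points, ∫ ξ, ∫ x', k ((ξ.1 ∪ η.1 ∪ {x'}) \ {x}, ξ.2 ∪ η.2) *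
      coeff cp x' x (removePlus η x) ξ ∂volume ∂(lambda2 d))
  - (∑ x ∈ η.1.points, ∫ ξ, k (ξ.1 ∪ η.1, ξ.2 ∪ η.2) *
      (∫ x', coeff cp x x' (removePlus η x) ξ) ∂(lambda2 d))
  + (∑ y ∈ η.2.points, ∫ ξ, ∫ y', k (ξ.1 ∪ η.1, (ξ.2 ∪ η.2 ∪ {y'}) \ {y}) *
      coeff cm y' y (removeMinus η y) ξ ∂volume ∂(lambda2 d))
  - (∑ y ∈ η.2.points, ∫ ξ, k (ξ.1 ∪ η.1, ξ.2 ∪ η.2) *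
      (∫ y', coeff cm y y' (removeMinus η y) ξ) ∂(lambda2 d))

/-- All integrals in the expression for `(L̂₁* k)(η)` are well-defined. -/
def WellDefined1 {d : ℕ} (cp cm : Rate d) (k : Pair d → ℝ) (η : Pair d) : Prop :=
  (∀ x ∈ η.1.points,
    IteratedIntegrable (fun ξ x' => k ((ξ.1 ∪ η.1 ∪ {x'}) \ {x}, ξ.2 ∪ η.2) *
      coeff cp x' x (removePlus η x) ξ) ∧
    WeightedIntegrable (fun ξ => k (ξ.1 ∪ η.1, ξ.2 ∪ η.2))
      (fun ξ x' => coeff cp x x' (removePlus η x) ξ)) ∧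
  (∀ y ∈ η.2.points,
    IteratedIntegrable (fun ξ y' => k (ξ.1 ∪ η.1, (ξ.2 ∪ η.2 ∪ {y'}) \ {y}) *
      coeff cm y' y (removeMinus η y) ξ) ∧
    WeightedIntegrable (fun ξ => k (ξ.1 ∪ η.1, ξ.2 ∪ η.2))
      (fun ξ y' => coeff cm y y' (removeMinus η y) ξ))

/-- The expression for `L̂₂* k` (rates `cp = c₂⁺`, `cm = c₂⁻`). -/
def dualL2 {d : ℕ} (cp cm : Rate d) (k : Pair d → ℝ) (η : Pair d) : ℝ :=
  (∑ y ∈ η.2.points, ∫ ξ, ∫ x, k (ξ.1 ∪ η.1 ∪ {x}, (ξ.2 ∪ η.2) \ {y}) *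
      coeff cp x y (removeMinus η y) ξ ∂volume ∂(lambda2 d))
  - (∑ x ∈ η.1.points, ∫ ξ, k (ξ.1 ∪ η.1, ξ.2 ∪ η.2) *
      (∫ y, coeff cp x y (removePlus η x) ξ) ∂(lambda2 d))
  + (∑ x ∈ η.1.points, ∫ ξ, ∫ y, k ((ξ.1 ∪ η.1) \ {x}, ξ.2 ∪ η.2 ∪ {y}) *
      coeff cm x y (removePlus η x) ξ ∂volume ∂(lambda2 d))
  - (∑ y ∈ η.2.points, ∫ ξ, ∫ x, k (ξ.1 ∪ η.1, ξ.2 ∪ η.2) *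
      coeff cm x y (removeMinus η y) ξ ∂volume ∂(lambda2 d))

/-- All integrals in the expression for `(L̂₂* k)(η)` are well-defined. -/
def WellDefined2 {d : ℕ} (cp cm : Rate d) (k : Pair d → ℝ) (η : Pair d) : Prop :=
  (∀ y ∈ η.2.points,
    IteratedIntegrable (fun ξ x => k (ξ.1 ∪ η.1 ∪ {x}, (ξ.2 ∪ η.2) \ {y}) *
      coeff cp x y (removeMinus η y) ξ) ∧
    IteratedIntegrable (fun ξ x => k (ξ.1 ∪ η.1, ξ.2 ∪ η.2) *
      coeff cm x y (removeMinus η y) ξ)) ∧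
  (∀ x ∈ η.1.points,
    WeightedIntegrable (fun ξ => k (ξ.1 ∪ η.1, ξ.2 ∪ η.2))
      (fun ξ y => coeff cp x y (removePlus η x) ξ) ∧
    IteratedIntegrable (fun ξ y => k ((ξ.1 ∪ η.1) \ {x}, ξ.2 ∪ η.2 ∪ {y}) *
      coeff cm x y (removePlus η x) ξ))

/-- `L` is a linear operator in `𝒦_C` whose domain is `𝒦_{C'}` (in particular `𝒦_{C'} ⊆ 𝒦_C`) and
which is given by the expression `E`: for each `k ∈ 𝒦_{C'}` and each representative `f` of `k`,
the expression `E f` is well-defined (`W f`) and equal to `L k`, `λ²`-almost everywhere. -/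
def IsOperatorGivenBy {d : ℕ} (C C' : ℝ) (W : (Pair d → ℝ) → Pair d → Prop)
    (E : (Pair d → ℝ) → Pair d → ℝ) (L : KSpace d C →ₗ.[ℝ] KSpace d C) : Prop :=
  L.domain.map (KSpace d C).subtype = KSpace d C' ∧
  ∀ k : L.domain, ∀ f : Pair d → ℝ,
    f =ᵐ[lambda2 d] ((k : KSpace d C) : Pair d →ₘ[lambda2 d] ℝ) →
      (∀ᵐ η ∂(lambda2 d), W f η) ∧
        (L k : Pair d →ₘ[lambda2 d] ℝ) =ᵐ[lambda2 d] E f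

end Hopping

end

namespace Hopping

open scoped NNReal

variable {d : ℕ}

/-! ### Measurability on the space of finite configurations -/

/-! Let `|k| ≤ B (αC)^{|·|}`. For `λ²`-a.a. `ξ` and a.a. `x'`, every configuration at which `k` is
evaluated has exactly `|η| + |ξ|` points: `ξ` misses `η`, and a jump removes one point and adds one.
Hence `(αC)^{|η|}` factors out. What remains of each term is at most `B` times the part of the
hypothesis attached to it, since `αC ≤ C`: `integralOfNorm` for a gain term, where `k` depends on
`x'`, and `normOfIntegral` for a loss term, where it does not. Altogether `|L̂* k(η)| ≤ B (αC)^{|η|}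
N(η) ≤ A B C^{|η|} (1 + |η|)^M (αν)^{|η|}`, and `αν < 1` bounds the last two factors.

The remaining work is measure theoretic. Independence of the representative means that union with
`ξ`, insertion of `x'` and removal of `x ∈ η` pull null sets back to null sets. On tuples these are
concatenation and coordinate projection, which preserve Lebesgue null sets
(`quasiMeasurePreserving_union`, `ae_remove`). Fubini's theorem needs joint measurability in
configurations and positions, which `measurable_conf_prod` reduces to tuples.

`IsTerm` isolates what a single term must satisfy: a.e. invariance, linearity, measurability, and
the estimate for functions bounded everywhere. It is stable under sums and negation.
`isTerm_iterated` and `isTerm_weighted` supply the gain and loss terms, and `IsTerm.exists_operator`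
turns a term into the operator. -/

@[simp] lemma union_points (η ξ : Conf d) : (η ∪ ξ).points = η.points ∪ ξ.points := by
  change (⟨_⟩ : Conf d).points = _
  congr!

@[simp] lemma sdiff_points (η ξ : Conf d) : (η \ ξ).points = η.points \ ξ.points := by
  change (⟨_⟩ : Conf d).points = _
  congr!

@[simp] lemma singleton_points (x : Site d) : ({x} : Conf d).points = {x} := rfl

/-- The configuration formed by the points `x i`, `i ∈ S`. -/
noncomputable def subConf {ι : Type*} (S : Finset ι) (x : ι → Site d) : Conf d := ⟨S.image x⟩

@[simp] lemma subConf_points {ι : Type*} (S : Finset ι) (x : ι → Site d) :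
    (subConf S x).points = S.image x := rfl

lemma toConf_eq (n : ℕ) (x : DistinctTuple d n) : toConf d n x = subConf Finset.univ x.1 := by
  ext1
  simp [toConf, Finset.map_eq_image, subConf]
  rfl

lemma toConf_card (n : ℕ) (x : DistinctTuple d n) : (toConf d n x).points.card = n := by
  simp [toConf]

lemma measurable_toConf (n : ℕ) : Measurable (toConf d n) := by
  rw [measurable_iff_le_map]
  exact iInf_le _ n

lemma measurable_conf_iff {Z : Type*} [MeasurableSpace Z] {f : Conf d → Z} :
    Measurable f ↔ ∀ n, Measurable fun x => f (toConf d n x) := by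
  refine ⟨fun h n => h.comp (measurable_toConf n), fun h s hs => ?_⟩
  rw [instMeasurableSpaceConf, MeasurableSpace.measurableSet_iInf]
  exact fun n => h n hs

lemma measurable_card : Measurable fun η : Conf d => η.points.card := by
  rw [measurable_conf_iff]
  intro n
  simp only [toConf_card]
  exact measurable_const

/-- The tuple `x` enumerates `η` in increasing order for the order pulled back from `ℝ`. -/
def IsSorting (n : ℕ) (η : Conf d) (x : Fin n → Site d) : Prop :=
  subConf Finset.univ x = η ∧ StrictMono (embeddingReal (Site d) ∘ x)

/-- Two strictly increasing maps from `Fin n` to `ℝ` with the same range coincide, and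
`embeddingReal` is injective. -/
lemma IsSorting.unique {n : ℕ} {η : Conf d} {x y : Fin n → Site d} (hx : IsSorting n η x)
    (hy : IsSorting n η y) : x = y := by
  have hinj := (measurableEmbedding_embeddingReal (Site d)).injective
  have hr : Set.range x = Set.range y := by
    have := congrArg (fun ζ : Conf d => (ζ.points : Set (Site d))) (hx.1.trans hy.1.symm)
    simpa using this
  have : embeddingReal (Site d) ∘ x = embeddingReal (Site d) ∘ y := by
    rw [← StrictMono.range_inj hx.2 hy.2, Set.range_comp, Set.range_comp, hr]
  exact hinj.comp_left this

lemma isSorting_sort {n : ℕ} (x : Fin n → Site d) (hx : Function.Injective x) :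
    IsSorting n (subConf Finset.univ x) (x ∘ Tuple.sort (embeddingReal (Site d) ∘ x)) := by
  have hinj := (measurableEmbedding_embeddingReal (Site d)).injective
  refine ⟨?_, ?_⟩
  · ext a
    simp only [subConf_points, Finset.mem_image, Finset.mem_univ, true_and, Function.comp_apply]
    exact ((Equiv.surjective (Tuple.sort _)).exists (p := fun i => x i = a)).symm
  · rw [← Function.comp_assoc]
    exact (Tuple.monotone_sort _).strictMono_of_injective
      ((hinj.comp hx).comp (Equiv.injective _))

/-- A measurable enumeration of `n`-point configurations. -/
noncomputable def enum (n : ℕ) (η : Conf d) : Fin n → Site d :=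
  if h : ∃ x, IsSorting n η x then h.choose else 0

lemma enum_eq {n : ℕ} {η : Conf d} {x : Fin n → Site d} (hx : IsSorting n η x) :
    enum n η = x := by
  have h : ∃ x, IsSorting n η x := ⟨x, hx⟩
  rw [enum, dif_pos h]
  exact h.choose_spec.unique hx

lemma measurableSet_injective (n : ℕ) : MeasurableSet (DistinctTuple d n) := by
  have : DistinctTuple d n = ⋂ i, ⋂ j, ⋂ (_ : i ≠ j), {x | x i = x j}ᶜ := by
    ext x
    simp only [DistinctTuple, Function.Injective, Set.mem_ofPred_eq, Set.mem_iInter,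
      Set.mem_compl_iff]
    exact ⟨fun h i j hij he => hij (h he), fun h i j he => by_contra fun hij => h i j hij he⟩
  rw [this]
  refine MeasurableSet.iInter fun i => MeasurableSet.iInter fun j => MeasurableSet.iInter fun _ =>
    (measurableSet_eq_fun (measurable_pi_apply i) (measurable_pi_apply j)).compl

/-- On tuples of the right length, `enum` permutes the coordinates by the permutation that sorts
them. Each permutation is the sorting one on a set given by finitely many strict inequalities, so a
preimage is a finite union of measurable sets. On other lengths the default value `0` is constant.
-/
lemma measurable_enum (n : ℕ) : Measurable (enum (d := d) n) := by
  rw [measurable_conf_iff]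
  intro m
  by_cases hm : m = n
  · subst hm
    intro B hB
    have : (fun x => enum m (toConf d m x)) ⁻¹' B = ⋃ σ : Equiv.Perm (Fin m),
        {x : DistinctTuple d m | StrictMono (embeddingReal (Site d) ∘ x.1 ∘ σ) ∧ x.1 ∘ σ ∈ B} := by
      ext x
      have key : ∀ σ : Equiv.Perm (Fin m), StrictMono (embeddingReal (Site d) ∘ x.1 ∘ σ) →
          enum m (toConf d m x) = x.1 ∘ σ := by
        intro σ hσ
        refine enum_eq ⟨?_, hσ⟩
        rw [toConf_eq]
        ext a
        simp only [subConf_points, Finset.mem_image, Finset.mem_univ, true_and,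
          Function.comp_apply]
        exact (σ.surjective.exists (p := fun i => x.1 i = a)).symm
      simp only [Set.mem_preimage, Set.mem_iUnion, Set.mem_ofPred_eq]
      constructor
      · intro hx
        have hs := (isSorting_sort x.1 x.2).2
        exact ⟨_, hs, key _ hs ▸ hx⟩
      · rintro ⟨σ, hσ, hx⟩
        rwa [key σ hσ]
    rw [this]
    have he := measurable_embeddingReal (Site d)
    have hc : ∀ i, Measurable fun x : DistinctTuple d m => x.1 i := fun i =>
      (measurable_pi_apply i).comp measurable_subtype_coe
    refine MeasurableSet.iUnion fun σ => MeasurableSet.inter ?_ ?_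
    · have : {x : DistinctTuple d m | StrictMono (embeddingReal (Site d) ∘ x.1 ∘ σ)} =
          ⋂ i, ⋂ j, ⋂ (_ : i < j), {x : DistinctTuple d m |
            embeddingReal (Site d) (x.1 (σ i)) < embeddingReal (Site d) (x.1 (σ j))} := by
        ext x
        simp [StrictMono]
      change MeasurableSet {x : DistinctTuple d m | StrictMono (embeddingReal (Site d) ∘ x.1 ∘ σ)}
      rw [this]
      exact MeasurableSet.iInter fun i => MeasurableSet.iInter fun j => MeasurableSet.iInter
        fun _ => measurableSet_lt (he.comp (hc _)) (he.comp (hc _))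
    · exact (measurable_pi_lambda _ fun i => hc (σ i)) hB
  · have : ∀ x, enum n (toConf d m x) = 0 := by
      intro x
      refine dif_neg ?_
      rintro ⟨y, hy, hmono⟩
      apply hm
      have hc := congrArg (fun ζ : Conf d => ζ.points.card) hy
      simp only [toConf_card, subConf_points] at hc
      rw [Finset.card_image_of_injective _ (Function.Injective.of_comp hmono.injective)] at hc
      simpa using hc.symm
    simp only [this]
    exact measurable_const

lemma exists_toConf_eq (η : Conf d) :
    ∃ x : DistinctTuple d η.points.card, toConf d η.points.card x = η := by
  refine ⟨⟨fun i => (η.points.equivFin.symm i : Site d), ?_⟩, ?_⟩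
  · exact Subtype.val_injective.comp (Equiv.injective _)
  · rw [toConf_eq]
    ext a
    simp only [subConf_points, Finset.mem_image, Finset.mem_univ, true_and]
    constructor
    · rintro ⟨i, rfl⟩
      exact Finset.coe_mem _
    · intro ha
      exact ⟨η.points.equivFin ⟨a, ha⟩, by simp⟩

lemma enum_spec (η : Conf d) : IsSorting η.points.card η (enum η.points.card η) := by
  obtain ⟨x, hx⟩ := exists_toConf_eq η
  have h := isSorting_sort x.1 x.2
  rw [← toConf_eq, hx] at h
  rwa [enum_eq h]

/-- Joint measurability in a configuration and a parameter can be tested on tuples. -/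
lemma measurable_conf_prod {Y Z : Type*} [MeasurableSpace Y] [MeasurableSpace Z]
    {f : Conf d × Y → Z}
    (h : ∀ n, Measurable fun p : DistinctTuple d n × Y => f (toConf d n p.1, p.2)) :
    Measurable f := by
  intro B hB
  -- A product with a final `σ`-algebra need not be final, so testing on tuples needs an argument.
  -- The measurable section `enum` writes the preimage through the image of a measurable set of
  -- tuples, and this image is measurable because the inclusion of injective tuples is a measurable
  -- embedding.
  have key : f ⁻¹' B = ⋃ n : ℕ, {p | p.1.points.card = n ∧ (enum n p.1, p.2) ∈
      Prod.map Subtype.val id '' ((fun p : DistinctTuple d n × Y =>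
        f (toConf d n p.1, p.2)) ⁻¹' B)} := by
    ext ⟨η, y⟩
    simp only [Set.mem_preimage, Set.mem_iUnion, Set.mem_ofPred_eq, Set.mem_image, Prod.exists,
      Prod.map_apply, id, Prod.mk.injEq]
    have hs := enum_spec η
    have hi : Function.Injective (enum η.points.card η) := hs.2.injective.of_comp
    constructor
    · intro hy
      refine ⟨_, rfl, ⟨_, hi⟩, y, ?_, rfl, rfl⟩
      rw [toConf_eq, hs.1]
      exact hy
    · rintro ⟨n, rfl, x, z, hxz, hx, rfl⟩
      rwa [toConf_eq, hx, hs.1] at hxz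
  rw [key]
  refine MeasurableSet.iUnion fun n => MeasurableSet.inter ?_ ?_
  · exact (measurable_card.comp measurable_fst) (measurableSet_singleton n)
  · have hme : MeasurableEmbedding (Prod.map (Subtype.val : DistinctTuple d n → _) (id : Y → Y)) :=
      (MeasurableEmbedding.subtype_coe (measurableSet_injective n)).prodMap MeasurableEmbedding.id
    exact (((measurable_enum n).comp measurable_fst).prodMk measurable_snd)
      (hme.measurableSet_image.2 (h n hB))

/-- The tuple gets longer only if the point is new. So the domain splits into two measurable pieces,
on which the map is `toConf d n` or `toConf d (n + 1)` of the extended tuple. -/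
lemma measurable_insert : Measurable fun p : Conf d × Site d => p.1 ∪ {p.2} := by
  refine measurable_conf_prod fun n => ?_
  have hA : MeasurableSet {p : DistinctTuple d n × Site d | ∃ i, p.1.1 i = p.2} := by
    rw [Set.ofPred_exists]
    exact MeasurableSet.iUnion fun i => measurableSet_eq_fun
      (((measurable_pi_apply i).comp measurable_subtype_coe).comp measurable_fst) measurable_snd
  refine measurable_of_restrict_of_restrict_compl hA ?_ ?_
  · have : Set.domRestrict {p : DistinctTuple d n × Site d | ∃ i, p.1.1 i = p.2}
        (fun p => toConf d n p.1 ∪ {p.2}) = fun p => toConf d n p.1.1 := by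
      funext ⟨⟨x, y⟩, i, hi⟩
      ext a
      simp only [Set.domRestrict_apply, toConf_eq, union_points, subConf_points, singleton_points,
        Finset.mem_union, Finset.mem_image, Finset.mem_univ, true_and, Finset.mem_singleton]
      constructor
      · rintro (h | rfl)
        exacts [h, ⟨i, hi⟩]
      · exact Or.inl
    rw [this]
    exact (measurable_toConf n).comp (measurable_fst.comp measurable_subtype_coe)
  · have hinj : ∀ p : ↥{p : DistinctTuple d n × Site d | ∃ i, p.1.1 i = p.2}ᶜ,
        Function.Injective (Fin.cons p.1.2 p.1.1.1 : Fin (n + 1) → Site d) := by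
      rintro ⟨⟨x, y⟩, h⟩
      rw [Fin.cons_injective_iff]
      exact ⟨h, x.2⟩
    have : Set.domRestrict {p : DistinctTuple d n × Site d | ∃ i, p.1.1 i = p.2}ᶜ
        (fun p => toConf d n p.1 ∪ {p.2}) = fun p => toConf d (n + 1) ⟨_, hinj p⟩ := by
      funext p
      ext a
      simp only [Set.domRestrict_apply, toConf_eq, union_points, subConf_points, singleton_points,
        Finset.mem_union, Finset.mem_image, Finset.mem_univ, true_and, Finset.mem_singleton,
        Fin.exists_fin_succ, Fin.cons_zero, Fin.cons_succ]
      rw [or_comm, eq_comm (a := a)]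
    rw [this]
    refine (measurable_toConf (n + 1)).comp (Measurable.subtype_mk (measurable_pi_lambda _ ?_))
    refine Fin.cases ?_ fun i => ?_
    · simp only [Fin.cons_zero]
      exact measurable_snd.comp measurable_subtype_coe
    · simp only [Fin.cons_succ]
      exact ((measurable_pi_apply i).comp measurable_subtype_coe).comp
        (measurable_fst.comp measurable_subtype_coe)

lemma measurable_union_subConf {ι : Type*} (S : Finset ι) :
    Measurable fun p : Conf d × (ι → Site d) => p.1 ∪ subConf S p.2 := by
  induction S using Finset.induction_on with
  | empty =>
    convert measurable_fst using 2 with p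
    ext a; simp
  | insert i S _ ih =>
    have : (fun p : Conf d × (ι → Site d) => p.1 ∪ subConf (insert i S) p.2) =
        fun p => (p.1 ∪ subConf S p.2) ∪ {p.2 i} := by
      funext p
      ext a
      simp
    rw [this]
    exact measurable_insert.comp (ih.prodMk ((measurable_pi_apply i).comp measurable_snd))

lemma measurable_subConf {ι : Type*} (S : Finset ι) :
    Measurable fun x : ι → Site d => subConf S x := by
  have := (measurable_union_subConf (d := d) S).comp (measurable_prodMk_left (x := ⟨∅⟩))
  convert this using 2 with x
  ext a; simp

lemma measurable_union : Measurable fun p : Conf d × Conf d => p.1 ∪ p.2 := by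
  have : Measurable fun p : Conf d × Conf d => p.2 ∪ p.1 := by
    refine measurable_conf_prod fun n => ?_
    simp only [toConf_eq]
    exact (measurable_union_subConf Finset.univ).comp
      (measurable_snd.prodMk (measurable_subtype_coe.comp measurable_fst))
  exact this.comp measurable_swap

lemma measurable_remove : Measurable fun p : Conf d × Site d => p.1 \ {p.2} := by
  refine measurable_conf_prod fun n => ?_
  simp only [toConf_eq]
  -- Removal has no uniform description on whole tuples. With an arbitrary index set in place of
  -- `univ`, the points can be treated one by one by induction.
  suffices H : ∀ S : Finset (Fin n), Measurable fun p : (Fin n → Site d) × Site d =>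
      subConf S p.1 \ {p.2} from
    (H Finset.univ).comp ((measurable_subtype_coe.comp measurable_fst).prodMk measurable_snd)
  intro S
  induction S using Finset.induction_on with
  | empty =>
    convert measurable_const (a := (⟨∅⟩ : Conf d)) using 2 with p
    ext a; simp
  | insert i S _ ih =>
    have : (fun p : (Fin n → Site d) × Site d => subConf (insert i S) p.1 \ {p.2}) =
        fun p => if p.1 i = p.2 then subConf S p.1 \ {p.2}
          else (subConf S p.1 \ {p.2}) ∪ {p.1 i} := by
      funext p
      split_ifs with h
      · ext a
        simp [h]
        exact fun h1 h2 => absurd h2 h1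
      · ext a
        simp only [sdiff_points, subConf_points, singleton_points, union_points,
          Finset.image_insert, Finset.mem_sdiff, Finset.mem_union, Finset.mem_insert,
          Finset.mem_singleton]
        constructor
        · tauto
        · rintro (h' | rfl) <;> tauto
    rw [this]
    have hi : Measurable fun p : (Fin n → Site d) × Site d => p.1 i :=
      (measurable_pi_apply i).comp measurable_fst
    exact Measurable.ite (measurableSet_eq_fun hi measurable_snd) ih
      (measurable_insert.comp (ih.prodMk hi))

/-! ### Finite sums over points and over subconfigurations -/

lemma measurable_sum_points {Y : Type*} [MeasurableSpace Y] {F : Site d → Conf d → Y → ℝ}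
    (hF : Measurable fun p : Site d × Conf d × Y => F p.1 p.2.1 p.2.2) :
    Measurable fun p : Conf d × Y => ∑ x ∈ p.1.points, F x p.1 p.2 := by
  refine measurable_conf_prod fun n => ?_
  have : (fun p : DistinctTuple d n × Y => ∑ x ∈ (toConf d n p.1).points, F x (toConf d n p.1) p.2)
      = fun p => ∑ i, F (p.1.1 i) (toConf d n p.1) p.2 := by
    funext p
    change ∑ x ∈ Finset.univ.map _, _ = _
    rw [Finset.sum_map]
    rfl
  rw [this]
  refine Finset.measurable_sum _ fun i _ => ?_
  exact hF.comp ((((measurable_pi_apply i).comp measurable_subtype_coe).comp measurable_fst).prodMk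
    (((measurable_toConf n).comp measurable_fst).prodMk measurable_snd))

lemma measurable_sum_powerset {Y : Type*} [MeasurableSpace Y] {F : Conf d → Conf d → Y → ℝ}
    (hF : Measurable fun p : Conf d × Conf d × Y => F p.1 p.2.1 p.2.2) :
    Measurable fun p : Conf d × Y => ∑ ζ ∈ p.1.points.powerset, F ⟨ζ⟩ p.1 p.2 := by
  refine measurable_conf_prod fun n => ?_
  have : (fun p : DistinctTuple d n × Y =>
      ∑ ζ ∈ (toConf d n p.1).points.powerset, F ⟨ζ⟩ (toConf d n p.1) p.2)
      = fun p => ∑ S : Finset (Fin n), F (subConf S p.1.1) (toConf d n p.1) p.2 := by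
    funext p
    -- Subconfigurations of an injective tuple correspond bijectively to subsets of `Fin n`, an
    -- index set that no longer depends on the configuration.
    have hp : (toConf d n p.1).points.powerset =
        (Finset.univ : Finset (Finset (Fin n))).image (fun S => S.image p.1.1) := by
      rw [toConf_eq, subConf_points]
      ext t
      simp only [Finset.mem_powerset, Finset.mem_image, Finset.mem_univ, true_and]
      rw [Finset.subset_image_iff]
      simp
    rw [hp, Finset.sum_image fun S _ T _ h => Finset.image_injective p.1.2 h]
    rfl
  rw [this]
  refine Finset.measurable_sum _ fun S _ => ?_
  exact hF.comp ((((measurable_subConf S).comp measurable_subtype_coe).comp measurable_fst).prodMk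
    (((measurable_toConf n).comp measurable_fst).prodMk measurable_snd))

/-! ### Operations on pairs of configurations and measurability of the coefficients -/

lemma measurable_size : Measurable (size (d := d)) :=
  (measurable_card.comp measurable_fst).add (measurable_card.comp measurable_snd)

lemma measurable_pairUnion :
    Measurable fun p : Pair d × Pair d => (p.1.1 ∪ p.2.1, p.1.2 ∪ p.2.2) :=
  (measurable_union.comp ((measurable_fst.comp measurable_fst).prodMk
    (measurable_fst.comp measurable_snd))).prodMk
  (measurable_union.comp ((measurable_snd.comp measurable_fst).prodMk
    (measurable_snd.comp measurable_snd)))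

lemma measurable_removePlus : Measurable fun p : Pair d × Site d => removePlus p.1 p.2 :=
  (measurable_remove.comp ((measurable_fst.comp measurable_fst).prodMk measurable_snd)).prodMk
    (measurable_snd.comp measurable_fst)

lemma measurable_removeMinus : Measurable fun p : Pair d × Site d => removeMinus p.1 p.2 :=
  (measurable_fst.comp measurable_fst).prodMk
    (measurable_remove.comp ((measurable_snd.comp measurable_fst).prodMk measurable_snd))

/-- The parameters of the summands of a coefficient. -/
abbrev CoeffParam (d : ℕ) := Conf d × Conf d × (Site d × Site d) × Pair d

/-- The summand of a coefficient that belongs to subconfigurations `ζ ⊆ η`, `ζ' ⊆ η'`. -/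
noncomputable def coeffSummand (c : Rate d) (ζ η : Conf d) (p : CoeffParam d) : ℝ :=
  (-1 : ℝ) ^ ((p.2.1.points.card - p.1.points.card) + (η.points.card - ζ.points.card)) *
    c p.2.2.1.1 p.2.2.1.2 (p.1 ∪ p.2.2.2.1, ζ ∪ p.2.2.2.2)

lemma measurable_coeffSummand {c : Rate d} (hc : IsRate c) :
    Measurable fun p : Conf d × Conf d × CoeffParam d => coeffSummand c p.1 p.2.1 p.2.2 := by
  have m0 : Measurable fun p : Conf d × Conf d × CoeffParam d => p.2.2 :=
    measurable_snd.comp measurable_snd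
  have m1 : Measurable fun p : Conf d × Conf d × CoeffParam d => p.2.2.1 :=
    measurable_fst.comp m0
  have m2 : Measurable fun p : Conf d × Conf d × CoeffParam d => p.2.2.2 :=
    measurable_snd.comp m0
  have m3 : Measurable fun p : Conf d × Conf d × CoeffParam d => p.2.2.2.2 :=
    measurable_snd.comp m2
  have m4 : Measurable fun p : Conf d × Conf d × CoeffParam d => p.2.2.2.2.2 :=
    measurable_snd.comp m3
  have n1 : Measurable fun p : Conf d × Conf d × CoeffParam d => p.2.2.1 ∪ p.2.2.2.2.2.1 :=
    measurable_union.comp (m1.prodMk (measurable_fst.comp m4))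
  have n2 : Measurable fun p : Conf d × Conf d × CoeffParam d => p.1 ∪ p.2.2.2.2.2.2 :=
    measurable_union.comp (measurable_fst.prodMk (measurable_snd.comp m4))
  have n3 := hc.measurable.comp ((measurable_fst.comp m3).prodMk (n1.prodMk n2))
  have n4 : Measurable fun p : Conf d × Conf d × CoeffParam d =>
      (p.2.2.2.1.points.card - p.2.2.1.points.card) + (p.2.1.points.card - p.1.points.card) :=
    ((measurable_card.comp (measurable_fst.comp m2)).sub (measurable_card.comp m1)).add
      ((measurable_card.comp (measurable_fst.comp measurable_snd)).sub
        (measurable_card.comp measurable_fst))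
  exact ((measurable_of_countable (fun n : ℕ => (-1 : ℝ) ^ n)).comp n4).mul n3

/-- The sum over the subconfigurations of `η` in a coefficient. -/
noncomputable def coeffInner (c : Rate d) (ζ' η' : Conf d)
    (p : Conf d × (Site d × Site d) × Pair d) : ℝ :=
  ∑ ζ ∈ p.1.points.powerset, coeffSummand c ⟨ζ⟩ p.1 (ζ', η', p.2)

lemma measurable_coeffInner {c : Rate d} (hc : IsRate c) :
    Measurable fun p : Conf d × Conf d × Conf d × (Site d × Site d) × Pair d =>
      coeffInner c p.1 p.2.1 p.2.2 := by
  have m : Measurable fun p : Conf d × Conf d × Conf d × (Site d × Site d) × Pair d =>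
      (p.2.2.1, p.1, p.2.1, p.2.2.2) := by fun_prop
  have h := measurable_sum_powerset (F := coeffSummand c) (measurable_coeffSummand hc)
  have h' := Measurable.comp h m
  exact h'

lemma coeff_eq_sum (c : Rate d) (x y : Site d) (ξ η : Pair d) :
    coeff c x y ξ η = ∑ ζ ∈ η.1.points.powerset, coeffInner c ⟨ζ⟩ η.1 (η.2, (x, y), ξ) := by
  unfold coeff Kinv coeffInner coeffSummand
  refine Finset.sum_congr rfl fun ζp hp => Finset.sum_congr rfl fun ζm hm => ?_
  -- The sign in `coeffSummand` uses truncated differences of cardinalities, which are visibly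
  -- measurable. They are the correct exponents because only subsets are summed over.
  rw [Finset.card_sdiff_of_subset (Finset.mem_powerset.1 hp),
    Finset.card_sdiff_of_subset (Finset.mem_powerset.1 hm)]

/-- The coefficients of a rate are jointly measurable. -/
lemma measurable_coeff {c : Rate d} (hc : IsRate c) :
    Measurable fun p : (Site d × Site d) × Pair d × Pair d =>
      coeff c p.1.1 p.1.2 p.2.1 p.2.2 := by
  simp only [coeff_eq_sum]
  have m : Measurable fun p : (Site d × Site d) × Pair d × Pair d =>
      (p.2.2.1, p.2.2.2, p.1, p.2.1) := by fun_prop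
  have h := measurable_sum_powerset (F := coeffInner c) (measurable_coeffInner hc)
  have h' := Measurable.comp h m
  exact h'

lemma measurable_insertPlus : Measurable fun p : Pair d × Site d => (p.1.1 ∪ {p.2}, p.1.2) := by
  have m : Measurable fun p : Pair d × Site d => (p.1.1, p.2) := by fun_prop
  have h := Measurable.comp measurable_insert m
  exact h.prodMk (by fun_prop)

lemma measurable_insertMinus : Measurable fun p : Pair d × Site d => (p.1.1, p.1.2 ∪ {p.2}) := by
  have m : Measurable fun p : Pair d × Site d => (p.1.2, p.2) := by fun_prop
  have h := Measurable.comp measurable_insert m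
  exact Measurable.prodMk (by fun_prop) h

/-! ### Null sets of the Lebesgue--Poisson measure -/

lemma measurableSet_ae_section {A B : Type*} [MeasurableSpace A] [MeasurableSpace B]
    {ν : Measure B} [SFinite ν] {P : A × B → Prop} (hP : MeasurableSet {p | P p}) :
    MeasurableSet {a | ∀ᵐ b ∂ν, P (a, b)} :=
  (measurable_measure_prodMk_left (ν := ν) hP.compl) (measurableSet_singleton 0)

lemma ae_ae_comm_of_measurableSet {A B : Type*} [MeasurableSpace A] [MeasurableSpace B]
    {μ : Measure A} {ν : Measure B} [SFinite μ] [SFinite ν] {P : A × B → Prop}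
    (hP : MeasurableSet {p | P p}) (h : ∀ᵐ b ∂ν, ∀ᵐ a ∂μ, P (a, b)) : ∀ᵐ p ∂μ.prod ν, P p := by
  rw [Measure.ae_prod_iff_ae_ae hP]
  exact (Measure.ae_ae_comm (p := fun a b => P (a, b)) hP).2 h

lemma ae_prod_ae_mem {A B X Z : Type*} [MeasurableSpace A] [MeasurableSpace B]
    [MeasurableSpace X] [MeasurableSpace Z] {μ : Measure A} {ν : Measure B} {τ : Measure X}
    [SFinite μ] [SFinite ν] [SFinite τ] {F : (A × B) × X → Z} (hF : Measurable F) {s : Set Z}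
    (hs : MeasurableSet s) (h : ∀ᵐ b ∂ν, ∀ᵐ a ∂μ, ∀ᵐ x ∂τ, F ((a, b), x) ∈ s) :
    ∀ᵐ p ∂μ.prod ν, ∀ᵐ x ∂τ, F (p, x) ∈ s :=
  ae_ae_comm_of_measurableSet (measurableSet_ae_section (hF hs)) h

/-- Two Fubini arguments on the components: the hypothesis treats both `+`-components before both
`-`-components, whereas null sets of pairs need one pair after the other. The exchange of `a'` and
`b` is the only nontrivial step. -/
lemma ae_prod_ae_prod_mem {A B A' B' Z : Type*} [MeasurableSpace A] [MeasurableSpace B]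
    [MeasurableSpace A'] [MeasurableSpace B'] [MeasurableSpace Z] {μ : Measure A} {ν : Measure B}
    {μ' : Measure A'} {ν' : Measure B'} [SFinite μ] [SFinite ν] [SFinite μ'] [SFinite ν']
    {F : (A × B) × (A' × B') → Z} (hF : Measurable F) {s : Set Z} (hs : MeasurableSet s)
    (h : ∀ᵐ a ∂μ, ∀ᵐ a' ∂μ', ∀ᵐ b ∂ν, ∀ᵐ b' ∂ν', F ((a, b), (a', b')) ∈ s) :
    ∀ᵐ p ∂μ.prod ν, ∀ᵐ q ∂μ'.prod ν', F (p, q) ∈ s := by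
  rw [Measure.ae_prod_iff_ae_ae (measurableSet_ae_section (P := fun p => F p ∈ s) (hF hs))]
  filter_upwards [h] with a ha
  have hF' : Measurable fun p : (A' × B) × B' => F ((a, p.1.2), (p.1.1, p.2)) := by fun_prop
  have h1 : ∀ᵐ b ∂ν, ∀ᵐ a' ∂μ', ∀ᵐ b' ∂ν', F ((a, b), (a', b')) ∈ s := by
    rw [← Measure.ae_ae_comm (p := fun a' b => ∀ᵐ b' ∂ν', F ((a, b), (a', b')) ∈ s)
      (measurableSet_ae_section (P := fun p : (A' × B) × B' => F ((a, p.1.2), (p.1.1, p.2)) ∈ s)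
        (hF' hs))]
    exact ha
  refine h1.mono fun b hb => ?_
  have hF2 : Measurable fun q : A' × B' => F ((a, b), q) := by fun_prop
  exact (Measure.ae_prod_iff_ae_ae (p := fun q => F ((a, b), q) ∈ s) (hF2 hs)).2 hb

lemma measurableSet_mem_points : MeasurableSet {p : Conf d × Site d | p.2 ∈ p.1.points} := by
  -- Membership is detected by whether removing the point lowers the cardinality.
  have : {p : Conf d × Site d | p.2 ∈ p.1.points} =
      {p | (p.1 \ {p.2}).points.card = p.1.points.card}ᶜ := by
    ext p
    simp only [Set.mem_ofPred_eq, Set.mem_compl_iff, sdiff_points, singleton_points,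
      Finset.sdiff_singleton_eq_erase]
    by_cases h : p.2 ∈ p.1.points
    · simpa [h] using (Finset.card_erase_lt_of_mem h).ne
    · simp [h]
  rw [this]
  exact (measurableSet_eq_fun (measurable_card.comp measurable_remove)
    (measurable_card.comp measurable_fst)).compl

lemma measurableSet_Conf2 : MeasurableSet (Conf2 d) := by
  have : Conf2 d = {η | (η.1 ∪ η.2).points.card = η.1.points.card + η.2.points.card} := by
    ext η
    simp only [Conf2, Set.mem_ofPred_eq, union_points]
    exact Finset.card_union_eq_card_add_card.symm
  rw [this]
  exact measurableSet_eq_fun (measurable_card.comp measurable_union) measurable_size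

lemma measurableSet_forall_points {Y : Type*} [MeasurableSpace Y] {P : Site d × Conf d × Y → Prop}
    (hP : MeasurableSet {p | P p}) :
    MeasurableSet {p : Conf d × Y | ∀ x ∈ p.1.points, P (x, p)} := by
  -- The condition holds at all points iff the sum of the indicators of its failure vanishes.
  have hm := measurable_sum_points
    (F := fun x η (y : Y) => Set.indicator {p | ¬ P p} (fun _ => (1 : ℝ)) (x, η, y))
    (measurable_const.indicator hP.compl)
  convert hm (measurableSet_singleton 0) using 1
  ext p
  simp only [Set.mem_ofPred_eq, Set.mem_preimage, Set.mem_singleton_iff]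
  rw [Finset.sum_eq_zero_iff_of_nonneg
    fun x _ => Set.indicator_nonneg (fun _ _ => zero_le_one) _]
  refine forall₂_congr fun x _ => ?_
  simp [Set.indicator]

lemma ae_mem_Conf2 : ∀ᵐ η ∂lambda2 d, η ∈ Conf2 d := ae_restrict_mem measurableSet_Conf2

/-! ### Consequences of positive dimension: diagonals and single points are null -/

section NeZero

variable [NeZero d]

/-- The diagonal is the kernel of a nonzero linear map, hence a proper subspace; `d ≥ 1` provides
the nonzero vector. -/
lemma volume_coord_eq {n : ℕ} {i j : Fin n} (hij : i ≠ j) :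
    volume {x : Fin n → Site d | x i = x j} = 0 := by
  have hs : {x : Fin n → Site d | x i = x j} = (LinearMap.ker
      ((LinearMap.proj i : (Fin n → Site d) →ₗ[ℝ] Site d) - LinearMap.proj j) : Set _) := by
    ext x
    simp [sub_eq_zero]
  rw [hs]
  refine Measure.addHaar_submodule _ _ fun htop => ?_
  obtain ⟨v, hv⟩ := exists_ne (0 : Site d)
  have : Pi.single i v ∈ LinearMap.ker
      ((LinearMap.proj i : (Fin n → Site d) →ₗ[ℝ] Site d) - LinearMap.proj j) := htop ▸ trivial
  simp [hij.symm] at this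
  exact hv this

lemma ae_injective (n : ℕ) : ∀ᵐ x : Fin n → Site d, x ∈ DistinctTuple d n := by
  have : ∀ᵐ x : Fin n → Site d, ∀ i j, i ≠ j → x i ≠ x j := by
    refine ae_all_iff.2 fun i => ae_all_iff.2 fun j => ?_
    by_cases hij : i = j
    · simp [hij]
    · simp only [ne_eq, hij, not_false_eq_true, forall_const]
      exact measure_eq_zero_iff_ae_notMem.1 (volume_coord_eq (d := d) hij)
  filter_upwards [this] with x hx
  intro i j h
  by_contra hij
  exact hx i j hij h

/-- Tuples with repetitions are null, so all tuples may be used in place of distinct ones. This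
removes the subtype from every later null set argument. -/
lemma lebesguePoisson_eq : lebesguePoisson d = Measure.sum fun n : ℕ =>
    ((n ! : ℕ) : ℝ≥0∞)⁻¹ • Measure.map (subConf Finset.univ)
      (volume : Measure (Fin n → Site d)) := by
  unfold lebesguePoisson
  congr 1
  funext n
  congr 1
  have h : toConf d n = subConf Finset.univ ∘ Subtype.val := funext (toConf_eq n)
  rw [h, ← Measure.map_map (measurable_subConf _) measurable_subtype_coe,
    map_comap_subtype_coe (measurableSet_injective n),
    Measure.restrict_eq_self_of_ae_mem (ae_injective n)]

instance : SFinite (lebesguePoisson d) := by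
  rw [lebesguePoisson_eq]
  infer_instance

lemma ae_lebesguePoisson_iff {P : Conf d → Prop} (hP : MeasurableSet {η | P η}) :
    (∀ᵐ η ∂lebesguePoisson d, P η) ↔
      ∀ n : ℕ, ∀ᵐ x : Fin n → Site d, P (subConf Finset.univ x) := by
  rw [lebesguePoisson_eq, Measure.ae_sum_iff' hP]
  refine forall_congr' fun n => ?_
  have h0 : ((n ! : ℕ) : ℝ≥0∞)⁻¹ ≠ 0 := ENNReal.inv_ne_zero.2 (ENNReal.natCast_ne_top _)
  rw [Measure.ae_ennreal_smul_measure_iff h0, ae_map_iff (measurable_subConf _).aemeasurable hP]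

/-- A general finite index type is allowed so that the union of an `n`-point and an `m`-point
configuration can be indexed by `Fin n ⊕ Fin m`. -/
lemma quasiMeasurePreserving_subConf {ι : Type*} [Fintype ι] :
    Measure.QuasiMeasurePreserving (subConf (d := d) (Finset.univ : Finset ι)) volume
      (lebesguePoisson d) := by
  refine ⟨measurable_subConf _, Measure.AbsolutelyContinuous.mk fun s hs h0 => ?_⟩
  rw [Measure.map_apply (measurable_subConf _) hs]
  have h1 : ∀ᵐ η ∂lebesguePoisson d, η ∉ s := measure_eq_zero_iff_ae_notMem.1 h0
  rw [ae_lebesguePoisson_iff hs.compl] at h1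
  have h2 := (volume_measurePreserving_piCongrLeft (fun _ => Site d)
    (Fintype.equivFin ι)).quasiMeasurePreserving.ae (h1 (Fintype.card ι))
  refine measure_eq_zero_iff_ae_notMem.2 ?_
  refine h2.mono fun x hx hxs => hx ?_
  convert Set.mem_preimage.1 hxs using 1
  ext a
  simp only [subConf_points, Finset.mem_image, Finset.mem_univ, true_and,
    MeasurableEquiv.coe_piCongrLeft]
  constructor
  swap
  · rintro ⟨i, rfl⟩
    exact ⟨Fintype.equivFin ι i, Equiv.piCongrLeft_apply_apply (P := fun _ => Site d) _ _ _⟩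
  · rintro ⟨i, rfl⟩
    exact ⟨_, (Equiv.piCongrLeft_apply_eq_cast (P := fun _ => Site d) _ _).symm⟩

lemma quasiMeasurePreserving_singleton :
    Measure.QuasiMeasurePreserving (fun x : Site d => ({x} : Conf d)) volume
      (lebesguePoisson d) := by
  have := (quasiMeasurePreserving_subConf (d := d) (ι := Unit)).comp
    ((volume_preserving_funUnique Unit (Site d)).symm _).quasiMeasurePreserving
  convert this using 2 with x
  ext a
  simp

lemma ae_notMem (x : Site d) : ∀ᵐ ξ ∂lebesguePoisson d, x ∉ ξ.points := by
  have hm : MeasurableSet {ξ : Conf d | x ∉ ξ.points} :=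
    (measurable_prodMk_right (y := x)) measurableSet_mem_points.compl
  rw [ae_lebesguePoisson_iff hm]
  intro n
  have : ∀ᵐ y : Fin n → Site d, ∀ i, y i ≠ x := ae_all_iff.2 fun i =>
    (Measure.quasiMeasurePreserving_eval (fun _ => (volume : Measure (Site d))) i).ae
      (Measure.ae_ne volume x)
  filter_upwards [this] with y hy
  simpa using hy

lemma ae_disjoint (η : Conf d) : ∀ᵐ ξ ∂lebesguePoisson d, Disjoint ξ.points η.points := by
  have : ∀ᵐ ξ ∂lebesguePoisson d, ∀ x ∈ η.points, x ∉ ξ.points :=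
    (ae_ball_iff η.points.countable_toSet).2 fun x _ => ae_notMem x
  filter_upwards [this] with ξ hξ
  exact Finset.disjoint_right.2 hξ

/-- For fixed `η⁻`, almost every `η⁺` avoids its finitely many points, so the restriction to `Γ₀²`
discards only a null set and the components can be treated independently. -/
lemma lambda2_eq : lambda2 d = (lebesguePoisson d).prod (lebesguePoisson d) := by
  refine Measure.restrict_eq_self_of_ae_mem ?_
  refine ae_ae_comm_of_measurableSet measurableSet_Conf2 (Filter.Eventually.of_forall fun η => ?_)
  exact ae_disjoint η

instance : SFinite (lambda2 d) := by
  rw [lambda2_eq]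
  infer_instance

lemma ae_lebesguePoisson_prod {P : Conf d × Conf d → Prop} (hP : MeasurableSet {p | P p})
    (h : ∀ n m : ℕ, ∀ᵐ p : (Fin n → Site d) × (Fin m → Site d),
      P (subConf Finset.univ p.1, subConf Finset.univ p.2)) :
    ∀ᵐ p ∂(lebesguePoisson d).prod (lebesguePoisson d), P p := by
  rw [Measure.ae_prod_iff_ae_ae hP, ae_lebesguePoisson_iff (measurableSet_ae_section hP)]
  intro n
  have : ∀ᵐ x : Fin n → Site d, ∀ m : ℕ, ∀ᵐ y : Fin m → Site d,
      P (subConf Finset.univ x, subConf Finset.univ y) :=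
    ae_all_iff.2 fun m => Measure.ae_ae_of_ae_prod (h n m)
  filter_upwards [this] with x hx
  exact (ae_lebesguePoisson_iff (P := fun b => P (subConf Finset.univ x, b))
    (measurable_prodMk_left hP)).2 hx

lemma quasiMeasurePreserving_union :
    Measure.QuasiMeasurePreserving (fun p : Conf d × Conf d => p.1 ∪ p.2)
      ((lebesguePoisson d).prod (lebesguePoisson d)) (lebesguePoisson d) := by
  refine ⟨measurable_union, Measure.AbsolutelyContinuous.mk fun s hs h0 => ?_⟩
  rw [Measure.map_apply measurable_union hs]
  have h1 : ∀ᵐ η ∂lebesguePoisson d, η ∉ s := measure_eq_zero_iff_ae_notMem.1 h0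
  refine measure_eq_zero_iff_ae_notMem.2 ?_
  refine ae_lebesguePoisson_prod (measurable_union hs.compl) fun n m => ?_
  have h2 := ((quasiMeasurePreserving_subConf (d := d) (ι := Fin n ⊕ Fin m)).comp
    (volume_measurePreserving_sumPiEquivProdPi_symm
      (fun _ : Fin n ⊕ Fin m => Site d)).quasiMeasurePreserving).ae h1
  refine h2.mono fun p hp hps => hp ?_
  convert Set.mem_preimage.1 hps using 1
  ext a
  simp [MeasurableEquiv.coe_sumPiEquivProdPi_symm, Equiv.sumPiEquivProdPi]

lemma ae_ae_insert {P : Conf d → Prop} (h : ∀ᵐ η ∂lebesguePoisson d, P η) :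
    ∀ᵐ η ∂lebesguePoisson d, ∀ᵐ x : Site d, P (η ∪ {x}) := by
  have h1 := (quasiMeasurePreserving_union (d := d)).ae h
  filter_upwards [Measure.ae_ae_of_ae_prod h1] with η hη
  exact quasiMeasurePreserving_singleton.ae hη

lemma ae_ae_union {P : Conf d → Prop} (h : ∀ᵐ η ∂lebesguePoisson d, P η) :
    ∀ᵐ η ∂lebesguePoisson d, ∀ᵐ ξ ∂lebesguePoisson d, P (ξ ∪ η) := by
  have h1 := ((quasiMeasurePreserving_union (d := d)).comp
    Measure.measurePreserving_swap.quasiMeasurePreserving).ae h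
  exact Measure.ae_ae_of_ae_prod h1

/-- On `(n + 1)`-tuples, deleting the `i`-th point is a coordinate projection onto `n`-tuples, under
which preimages of null sets are null; there are only finitely many `i`. -/
lemma ae_remove {P : Conf d → Prop} (h : ∀ᵐ η ∂lebesguePoisson d, P η) :
    ∀ᵐ η ∂lebesguePoisson d, ∀ x ∈ η.points, P (η \ {x}) := by
  obtain ⟨s, hs, hsm, hsP⟩ := h.exists_measurable_mem
  suffices H : ∀ᵐ η ∂lebesguePoisson d, ∀ x ∈ η.points, η \ {x} ∈ s from
    H.mono fun η hη x hx => hsP _ (hη x hx)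
  have hm : MeasurableSet {η : Conf d | ∀ x ∈ η.points, η \ {x} ∈ s} := by
    have := measurableSet_forall_points (d := d) (Y := Unit)
      (P := fun p => p.2.1 \ {p.1} ∈ s)
      ((measurable_remove.comp ((measurable_fst.comp measurable_snd).prodMk measurable_fst)) hsm)
    exact (measurable_prodMk_right (y := ())) this
  rw [ae_lebesguePoisson_iff hm]
  rintro (_ | n)
  · exact Filter.Eventually.of_forall fun x => by simp
  have h1 : ∀ᵐ y : Fin n → Site d, subConf Finset.univ y ∈ s :=
    quasiMeasurePreserving_subConf.ae hs
  have h2 : ∀ᵐ x : Fin (n + 1) → Site d, ∀ i : Fin (n + 1),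
      subConf Finset.univ (fun j => x (i.succAbove j)) ∈ s := ae_all_iff.2 fun i =>
    (Measure.quasiMeasurePreserving_snd.comp (volume_preserving_piFinSuccAbove
      (fun _ : Fin (n + 1) => Site d) i).quasiMeasurePreserving).ae h1
  -- Injectivity is needed because removing the point `x i` would otherwise also remove its
  -- repetitions.
  filter_upwards [h2, ae_injective (d := d) (n + 1)] with x hx hinj y hy
  obtain ⟨i, -, rfl⟩ := Finset.mem_image.1 hy
  convert hx i using 1
  ext a
  simp only [sdiff_points, subConf_points, singleton_points, Finset.mem_sdiff, Finset.mem_image,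
    Finset.mem_univ, true_and, Finset.mem_singleton]
  constructor
  · rintro ⟨⟨j, rfl⟩, hj⟩
    obtain ⟨l, rfl⟩ := Fin.exists_succAbove_eq (y := i) (x := j) fun hji => hj (by rw [hji])
    exact ⟨l, rfl⟩
  · rintro ⟨l, rfl⟩
    exact ⟨⟨_, rfl⟩, fun he => Fin.succAbove_ne i l (hinj he)⟩

/-! ### Null sets of the measure on pairs of configurations -/

lemma ae_swap {P : Pair d → Prop} (h : ∀ᵐ η ∂lambda2 d, P η) :
    ∀ᵐ η ∂lambda2 d, P η.swap := by
  rw [lambda2_eq] at h ⊢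
  exact Measure.measurePreserving_swap.quasiMeasurePreserving.ae h

lemma ae_ae_pairUnion {P : Pair d → Prop} (h : ∀ᵐ η ∂lambda2 d, P η) :
    ∀ᵐ η ∂lambda2 d, ∀ᵐ ξ ∂lambda2 d, P (ξ.1 ∪ η.1, ξ.2 ∪ η.2) := by
  obtain ⟨s, hs, hsm, hsP⟩ := h.exists_measurable_mem
  suffices H : ∀ᵐ η ∂lambda2 d, ∀ᵐ ξ ∂lambda2 d, (ξ.1 ∪ η.1, ξ.2 ∪ η.2) ∈ s from
    H.mono fun η hη => hη.mono fun ξ hξ => hsP _ hξ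
  have m : Measurable fun p : (Pair d) × Pair d => (p.2.1 ∪ p.1.1, p.2.2 ∪ p.1.2) :=
    measurable_pairUnion.comp measurable_swap
  rw [lambda2_eq] at hs ⊢
  refine ae_prod_ae_prod_mem m hsm ?_
  filter_upwards [ae_ae_union (Measure.ae_ae_of_ae_prod hs)] with a ha
  filter_upwards [ha] with c hc
  exact ae_ae_union (P := fun b => (c ∪ a, b) ∈ s) hc

lemma ae_removePlus {P : Pair d → Prop} (h : ∀ᵐ η ∂lambda2 d, P η) :
    ∀ᵐ η ∂lambda2 d, ∀ x ∈ η.1.points, P (removePlus η x) := by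
  obtain ⟨s, hs, hsm, hsP⟩ := h.exists_measurable_mem
  suffices H : ∀ᵐ η ∂lambda2 d, ∀ x ∈ η.1.points, removePlus η x ∈ s from
    H.mono fun η hη x hx => hsP _ (hη x hx)
  have h1 := ae_swap hs
  have hm : MeasurableSet {η : Pair d | ∀ x ∈ η.1.points, removePlus η x ∈ s} :=
    measurableSet_forall_points (P := fun p => removePlus p.2 p.1 ∈ s)
      ((measurable_removePlus.comp measurable_swap) hsm)
  rw [lambda2_eq] at h1 ⊢
  refine ae_ae_comm_of_measurableSet hm ?_
  filter_upwards [Measure.ae_ae_of_ae_prod h1] with η hη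
  exact ae_remove (P := fun a => (a, η) ∈ s) hη

lemma ae_removeMinus {P : Pair d → Prop} (h : ∀ᵐ η ∂lambda2 d, P η) :
    ∀ᵐ η ∂lambda2 d, ∀ x ∈ η.2.points, P (removeMinus η x) :=
  ae_swap (ae_removePlus (ae_swap h))

lemma ae_ae_insertPlus {P : Pair d → Prop} (h : ∀ᵐ η ∂lambda2 d, P η) :
    ∀ᵐ η ∂lambda2 d, ∀ᵐ x : Site d, P (η.1 ∪ {x}, η.2) := by
  obtain ⟨s, hs, hsm, hsP⟩ := h.exists_measurable_mem
  suffices H : ∀ᵐ η ∂lambda2 d, ∀ᵐ x : Site d, (η.1 ∪ {x}, η.2) ∈ s from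
    H.mono fun η hη => hη.mono fun x hx => hsP _ hx
  have h1 := ae_swap hs
  rw [lambda2_eq] at h1 ⊢
  refine ae_prod_ae_mem measurable_insertPlus hsm ?_
  filter_upwards [Measure.ae_ae_of_ae_prod h1] with η hη
  exact ae_ae_insert (P := fun a => (a, η) ∈ s) hη

lemma ae_ae_insertMinus {P : Pair d → Prop} (h : ∀ᵐ η ∂lambda2 d, P η) :
    ∀ᵐ η ∂lambda2 d, ∀ᵐ x : Site d, P (η.1, η.2 ∪ {x}) :=
  ae_swap (ae_ae_insertPlus (ae_swap h))

end NeZero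

/-! ### Operators of the form needed for the dual generators -/

/-- An operator `t`, with domain of definition `w`, whose values at functions bounded by
`C' ^ |·|` are controlled by `b`. -/
structure IsTerm (C' : ℝ) (b : Pair d → ℝ≥0∞) (w : (Pair d → ℝ) → Pair d → Prop)
    (t : (Pair d → ℝ) → Pair d → ℝ) : Prop where
  congr : ∀ f g : Pair d → ℝ, f =ᵐ[lambda2 d] g →
    ∀ᵐ η ∂lambda2 d, (w f η → w g η) ∧ t f η = t g η
  add : ∀ f g η, w f η → w g η → t (f + g) η = t f η + t g η
  smul : ∀ (a : ℝ) f η, t (a • f) η = a * t f η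
  bound : ∀ g : Pair d → ℝ, Measurable g → ∀ B : ℝ≥0,
    (∀ ζ, ‖g ζ‖ₑ ≤ B * ENNReal.ofReal C' ^ size ζ) → ∀ η, b η ≠ ∞ →
      w g η ∧ ‖t g η‖ₑ ≤ B * ENNReal.ofReal C' ^ size η * b η
  measurable : ∀ g : Pair d → ℝ, Measurable g → Measurable (t g)

namespace IsTerm

variable {C' : ℝ} {b₁ b₂ : Pair d → ℝ≥0∞} {w₁ w₂ : (Pair d → ℝ) → Pair d → Prop}
  {t₁ t₂ : (Pair d → ℝ) → Pair d → ℝ}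

lemma mono_bound (h : IsTerm C' b₁ w₁ t₁) (hb : ∀ η, b₁ η ≤ b₂ η) : IsTerm C' b₂ w₁ t₁ where
  congr := h.congr
  add := h.add
  smul := h.smul
  bound g hg B hB η hη := by
    obtain ⟨h1, h2⟩ := h.bound g hg B hB η (ne_top_of_le_ne_top hη (hb η))
    exact ⟨h1, h2.trans (by gcongr; exact hb η)⟩
  measurable := h.measurable

lemma neg (h : IsTerm C' b₁ w₁ t₁) : IsTerm C' b₁ w₁ (fun k η => - t₁ k η) where
  congr f g hfg := (h.congr f g hfg).mono fun η hη => ⟨hη.1, by rw [hη.2]⟩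
  add f g η hf hg := by rw [h.add f g η hf hg]; ring
  smul a f η := by rw [h.smul]; ring
  bound g hg B hB η hη := by
    rw [enorm_neg]
    exact h.bound g hg B hB η hη
  measurable g hg := (h.measurable g hg).neg

lemma sum (h₁ : IsTerm C' b₁ w₁ t₁) (h₂ : IsTerm C' b₂ w₂ t₂) :
    IsTerm C' (fun η => b₁ η + b₂ η) (fun k η => w₁ k η ∧ w₂ k η)
      (fun k η => t₁ k η + t₂ k η) where
  congr f g hfg := by
    filter_upwards [h₁.congr f g hfg, h₂.congr f g hfg] with η e₁ e₂
    exact ⟨fun h => ⟨e₁.1 h.1, e₂.1 h.2⟩, by rw [e₁.2, e₂.2]⟩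
  add f g η hf hg := by rw [h₁.add f g η hf.1 hg.1, h₂.add f g η hf.2 hg.2]; ring
  smul a f η := by rw [h₁.smul, h₂.smul]; ring
  bound g hg B hB η hη := by
    obtain ⟨hη₁, hη₂⟩ := ENNReal.add_ne_top.1 hη
    obtain ⟨a₁, c₁⟩ := h₁.bound g hg B hB η hη₁
    obtain ⟨a₂, c₂⟩ := h₂.bound g hg B hB η hη₂
    refine ⟨⟨a₁, a₂⟩, (enorm_add_le _ _).trans ?_⟩
    rw [mul_add]
    exact add_le_add c₁ c₂
  measurable g hg := (h₁.measurable g hg).add (h₂.measurable g hg)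

end IsTerm

/-! ### Iterated integrals -/

section Iterated

variable {F G : Pair d → Site d → ℝ}

/-- By Tonelli's theorem the hypothesis is integrability on the product, and Fubini's theorem then
gives both parts. -/
lemma iteratedIntegrable_of_lintegral [NeZero d]
    (hF : Measurable fun p : Pair d × Site d => F p.1 p.2)
    (h : ∫⁻ ξ, ∫⁻ x, ‖F ξ x‖ₑ ∂volume ∂lambda2 d ≠ ∞) : IteratedIntegrable F := by
  have hi : Integrable (fun p : Pair d × Site d => F p.1 p.2) ((lambda2 d).prod volume) := by
    refine ⟨hF.aestronglyMeasurable, ?_⟩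
    rw [hasFiniteIntegral_iff_enorm, lintegral_prod _ hF.enorm.aemeasurable]
    exact h.lt_top
  exact ⟨hi.prod_right_ae, hi.integral_prod_left⟩

lemma enorm_iterated_le :
    ‖∫ ξ, ∫ x, F ξ x ∂volume ∂lambda2 d‖ₑ ≤ ∫⁻ ξ, ∫⁻ x, ‖F ξ x‖ₑ ∂volume ∂lambda2 d :=
  (enorm_integral_le_lintegral_enorm _).trans
    (lintegral_mono fun _ => enorm_integral_le_lintegral_enorm _)

lemma iterated_congr (h : ∀ᵐ ξ ∂lambda2 d, F ξ =ᵐ[volume] G ξ) :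
    (IteratedIntegrable F → IteratedIntegrable G) ∧
      ∫ ξ, ∫ x, F ξ x ∂volume ∂lambda2 d = ∫ ξ, ∫ x, G ξ x ∂volume ∂lambda2 d := by
  have h' : (fun ξ => ∫ x, F ξ x) =ᵐ[lambda2 d] fun ξ => ∫ x, G ξ x :=
    h.mono fun ξ hξ => integral_congr_ae hξ
  refine ⟨fun hF => ⟨?_, hF.2.congr h'⟩, integral_congr_ae h'⟩
  filter_upwards [h, hF.1] with ξ hξ hi
  exact hi.congr hξ

lemma IteratedIntegrable.integral_add (hF : IteratedIntegrable F) (hG : IteratedIntegrable G) :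
    ∫ ξ, ∫ x, (F ξ x + G ξ x) ∂volume ∂lambda2 d =
      (∫ ξ, ∫ x, F ξ x ∂volume ∂lambda2 d) + ∫ ξ, ∫ x, G ξ x ∂volume ∂lambda2 d := by
  rw [← MeasureTheory.integral_add hF.2 hG.2]
  refine integral_congr_ae ?_
  filter_upwards [hF.1, hG.1] with ξ h1 h2
  exact MeasureTheory.integral_add h1 h2

end Iterated

lemma ae_size_pairUnion [NeZero d] (η : Pair d) : ∀ᵐ ξ ∂lambda2 d,
    size ((ξ.1 ∪ η.1, ξ.2 ∪ η.2) : Pair d) = size η + size ξ := by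
  rw [lambda2_eq]
  filter_upwards [Measure.quasiMeasurePreserving_fst.ae (ae_disjoint η.1),
    Measure.quasiMeasurePreserving_snd.ae (ae_disjoint η.2)] with ξ h1 h2
  simp only [size, union_points]
  rw [Finset.card_union_of_disjoint h1, Finset.card_union_of_disjoint h2]
  ring

lemma sum_bound {sel : Finset (Site d)} {t : Site d → ℝ} {b : Site d → ℝ≥0∞} {K : ℝ≥0∞}
    (h : ∀ x ∈ sel, ‖t x‖ₑ ≤ K * b x) : ‖∑ x ∈ sel, t x‖ₑ ≤ K * ∑ x ∈ sel, b x := by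
  rw [Finset.mul_sum]
  exact (enorm_sum_le _ _).trans (Finset.sum_le_sum h)

/-- A choice of one of the two components of a pair of configurations. -/
def IsSide (sel : Pair d → Finset (Site d)) : Prop :=
  ∀ F : Site d → Pair d → ℝ, (Measurable fun p : Pair d × Site d => F p.2 p.1) →
    Measurable fun η => ∑ x ∈ sel η, F x η

lemma isSide_plus : IsSide (fun η : Pair d => η.1.points) := by
  intro F hF
  have m : Measurable fun p : Site d × Conf d × Conf d => ((p.2.1, p.2.2), p.1) := by fun_prop
  exact measurable_sum_points (F := fun x η y => F x (η, y)) (hF.comp m)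

lemma isSide_minus : IsSide (fun η : Pair d => η.2.points) := by
  intro F hF
  have m : Measurable fun p : Site d × Conf d × Conf d => ((p.2.2, p.2.1), p.1) := by fun_prop
  exact (measurable_sum_points (F := fun x η y => F x (y, η)) (hF.comp m)).comp measurable_swap

/-- The configuration `J η x ξ x'` that results from a jump between `x` and `x'`. -/
structure IsJump (sel : Pair d → Finset (Site d))
    (J : Pair d → Site d → Pair d → Site d → Pair d) : Prop where
  measurable : Measurable fun p : (Pair d × Site d) × Pair d × Site d =>
    J p.1.1 p.1.2 p.2.1 p.2.2
  ae : ∀ P : Pair d → Prop, (∀ᵐ ζ ∂lambda2 d, P ζ) →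
    ∀ᵐ η ∂lambda2 d, ∀ x ∈ sel η, ∀ᵐ ξ ∂lambda2 d, ∀ᵐ x' : Site d, P (J η x ξ x')
  size_eq : ∀ η, ∀ x ∈ sel η, ∀ᵐ ξ ∂lambda2 d, ∀ᵐ x' : Site d,
    size (J η x ξ x') = size η + size ξ

section Terms

variable [NeZero d] {C C' : ℝ} {sel : Pair d → Finset (Site d)}
  {J : Pair d → Site d → Pair d → Site d → Pair d} {D : Pair d → Site d → Pair d → Site d → ℝ}

lemma isTerm_iterated (hC : C' ≤ C) (hsel : IsSide sel) (hJ : IsJump sel J)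
    (hD : Measurable fun p : (Pair d × Site d) × Pair d × Site d => D p.1.1 p.1.2 p.2.1 p.2.2) :
    IsTerm C' (fun η => ∑ x ∈ sel η, integralOfNorm C (fun x' ξ => D η x ξ x'))
      (fun k η => ∀ x ∈ sel η,
        IteratedIntegrable (fun ξ x' => k (J η x ξ x') * D η x ξ x'))
      (fun k η => ∑ x ∈ sel η, ∫ ξ, ∫ x', k (J η x ξ x') * D η x ξ x' ∂volume ∂lambda2 d) where
  congr f g hfg := by
    filter_upwards [hJ.ae _ hfg] with η hη
    have key : ∀ x ∈ sel η, _ := fun x hx => iterated_congr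
      (F := fun ξ x' => f (J η x ξ x') * D η x ξ x')
      (G := fun ξ x' => g (J η x ξ x') * D η x ξ x')
      ((hη x hx).mono fun ξ hξ => hξ.mono fun x' hx' => by simp only [hx'])
    exact ⟨fun h x hx => (key x hx).1 (h x hx), Finset.sum_congr rfl fun x hx => (key x hx).2⟩
  add f g η hf hg := by
    rw [← Finset.sum_add_distrib]
    refine Finset.sum_congr rfl fun x hx => ?_
    rw [← (hf x hx).integral_add (hg x hx)]
    simp only [Pi.add_apply, add_mul]
  -- No integrability is needed: pulling a constant out of a Bochner integral is valid
  -- unconditionally, unlike additivity.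
  smul a f η := by
    simp only [Pi.smul_apply, smul_eq_mul, mul_assoc, integral_const_mul, Finset.mul_sum]
  bound g hg B hB η hη := by
    have hm : ∀ x, Measurable fun p : Pair d × Site d => J η x p.1 p.2 := fun x =>
      hJ.measurable.comp (measurable_prodMk_left (x := (η, x)))
    have hDm : ∀ x, Measurable fun p : Pair d × Site d => D η x p.1 p.2 := fun x =>
      hD.comp (measurable_prodMk_left (x := (η, x)))
    have hle : ∀ x ∈ sel η, ∫⁻ ξ, ∫⁻ x', ‖g (J η x ξ x') * D η x ξ x'‖ₑ ∂volume ∂lambda2 d ≤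
        B * ENNReal.ofReal C' ^ size η * integralOfNorm C (fun x' ξ => D η x ξ x') := by
      intro x hx
      have hDC : Measurable fun p : Pair d × Site d =>
          ‖D η x p.1 p.2‖ₑ * ENNReal.ofReal C ^ size p.1 :=
        (hDm x).enorm.mul ((measurable_of_countable (fun n : ℕ => ENNReal.ofReal C ^ n)).comp
          (measurable_size.comp measurable_fst))
      calc ∫⁻ ξ, ∫⁻ x', ‖g (J η x ξ x') * D η x ξ x'‖ₑ ∂volume ∂lambda2 d
          ≤ ∫⁻ ξ, ∫⁻ x', (B * ENNReal.ofReal C' ^ size η) *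
            (‖D η x ξ x'‖ₑ * ENNReal.ofReal C ^ size ξ) ∂volume ∂lambda2 d := by
            -- The pointwise bound on `g` at the jumped configuration splits into an `η`-factor and
            -- a `ξ`-factor because the sizes add almost everywhere.
            refine lintegral_mono_ae ((hJ.size_eq η x hx).mono fun ξ hξ =>
              lintegral_mono_ae (hξ.mono fun x' hx' => ?_))
            rw [enorm_mul]
            calc ‖g (J η x ξ x')‖ₑ * ‖D η x ξ x'‖ₑ
                ≤ (B * ENNReal.ofReal C' ^ (size η + size ξ)) * ‖D η x ξ x'‖ₑ := by
                  gcongr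
                  exact hx' ▸ hB _
              _ = (B * ENNReal.ofReal C' ^ size η) *
                  (‖D η x ξ x'‖ₑ * ENNReal.ofReal C' ^ size ξ) := by ring
              _ ≤ _ := by gcongr
        _ = ∫⁻ x', ∫⁻ ξ, (B * ENNReal.ofReal C' ^ size η) *
            (‖D η x ξ x'‖ₑ * ENNReal.ofReal C ^ size ξ) ∂lambda2 d :=
            lintegral_lintegral_swap (measurable_const.mul hDC).aemeasurable
        _ = (B * ENNReal.ofReal C' ^ size η) * integralOfNorm C (fun x' ξ => D η x ξ x') := by
            have h1 : ∀ x' : Site d, Measurable fun ξ =>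
                ‖D η x ξ x'‖ₑ * ENNReal.ofReal C ^ size ξ := fun x' =>
              hDC.comp (measurable_prodMk_right (y := x'))
            simp only [lintegral_const_mul _ (h1 _)]
            rw [lintegral_const_mul _ hDC.lintegral_prod_left']
            rfl
    refine ⟨fun x hx => iteratedIntegrable_of_lintegral ((hg.comp (hm x)).mul (hDm x)) ?_,
      sum_bound fun x hx => enorm_iterated_le.trans (hle x hx)⟩
    refine ne_top_of_le_ne_top (ENNReal.mul_ne_top ?_ ?_) (hle x hx)
    · exact ENNReal.mul_ne_top ENNReal.coe_ne_top (ENNReal.pow_ne_top ENNReal.ofReal_ne_top)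
    · exact fun h => hη (ENNReal.sum_eq_top.2 ⟨x, hx, h⟩)
  measurable g hg := by
    refine hsel (fun x η => ∫ ξ, ∫ x', g (J η x ξ x') * D η x ξ x' ∂volume ∂lambda2 d) ?_
    have h0 : StronglyMeasurable fun p : ((Pair d × Site d) × Pair d) × Site d =>
        g (J p.1.1.1 p.1.1.2 p.1.2 p.2) * D p.1.1.1 p.1.1.2 p.1.2 p.2 := by
      have := (hg.comp hJ.measurable).mul hD
      exact (Measurable.comp this MeasurableEquiv.prodAssoc.measurable).stronglyMeasurable
    exact h0.integral_prod_right'.integral_prod_right'.measurable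

omit [NeZero d] in
-- Where the inner integral fails to exist, the integrand of `normOfIntegral` is `∞` times a
-- positive number, so finiteness confines this to a null set.
lemma normOfIntegral_ae_integrable {G : Pair d → Site d → ℝ} (hC : 0 < C)
    (hG : Measurable fun p : Pair d × Site d => G p.1 p.2)
    (h : normOfIntegral C (fun x ξ => G ξ x) ≠ ∞) :
    ∀ᵐ ξ ∂lambda2 d, Integrable (G ξ) volume := by
  have hm : Measurable fun ξ => (if Integrable (fun x => G ξ x) volume
      then ‖∫ x, G ξ x‖ₑ else ∞) * ENNReal.ofReal C ^ size ξ := by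
    refine Measurable.mul (Measurable.ite ?_ ?_ measurable_const)
      ((measurable_of_countable (fun n : ℕ => ENNReal.ofReal C ^ n)).comp measurable_size)
    · exact measurableSet_integrable hG.stronglyMeasurable
    · exact hG.stronglyMeasurable.integral_prod_right'.measurable.enorm
  filter_upwards [ae_lt_top hm h] with ξ hξ
  by_contra hn
  rw [if_neg hn, ENNReal.top_mul (by simp [hC])] at hξ
  exact lt_irrefl _ hξ

/-- Here `k` does not depend on the inner variable, so the absolute value is taken only after
integrating over it, and cancellation in that integral is kept. -/
lemma isTerm_weighted (hC0 : 0 < C) (hC : C' ≤ C) (hsel : IsSide sel)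
    (hD : Measurable fun p : (Pair d × Site d) × Pair d × Site d => D p.1.1 p.1.2 p.2.1 p.2.2) :
    IsTerm C' (fun η => ∑ x ∈ sel η, normOfIntegral C (fun x' ξ => D η x ξ x'))
      (fun k η => ∀ x ∈ sel η, WeightedIntegrable (fun ξ => k (ξ.1 ∪ η.1, ξ.2 ∪ η.2))
        (fun ξ x' => D η x ξ x'))
      (fun k η => ∑ x ∈ sel η, ∫ ξ, k (ξ.1 ∪ η.1, ξ.2 ∪ η.2) * (∫ x', D η x ξ x')
        ∂lambda2 d) where
  congr f g hfg := by
    filter_upwards [ae_ae_pairUnion hfg] with η hη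
    have key : ∀ x, (fun ξ => f (ξ.1 ∪ η.1, ξ.2 ∪ η.2) * (∫ x', D η x ξ x')) =ᵐ[lambda2 d]
        fun ξ => g (ξ.1 ∪ η.1, ξ.2 ∪ η.2) * (∫ x', D η x ξ x') := fun x =>
      hη.mono fun ξ hξ => by simp only [hξ]
    exact ⟨fun h x hx => ⟨(h x hx).1, (h x hx).2.congr (key x)⟩,
      Finset.sum_congr rfl fun x _ => integral_congr_ae (key x)⟩
  add f g η hf hg := by
    rw [← Finset.sum_add_distrib]
    refine Finset.sum_congr rfl fun x hx => ?_
    rw [← integral_add (hf x hx).2 (hg x hx).2]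
    simp only [Pi.add_apply, add_mul]
  smul a f η := by
    simp only [Pi.smul_apply, smul_eq_mul, mul_assoc, integral_const_mul, Finset.mul_sum]
  bound g hg B hB η hη := by
    have hDm : ∀ x, Measurable fun p : Pair d × Site d => D η x p.1 p.2 := fun x =>
      hD.comp (measurable_prodMk_left (x := (η, x)))
    have hfin : ∀ x ∈ sel η, normOfIntegral C (fun x' ξ => D η x ξ x') ≠ ∞ :=
      fun x hx h => hη (ENNReal.sum_eq_top.2 ⟨x, hx, h⟩)
    have hint : ∀ x ∈ sel η, ∀ᵐ ξ ∂lambda2 d, Integrable (D η x ξ) volume := fun x hx =>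
      normOfIntegral_ae_integrable hC0 (hDm x) (hfin x hx)
    have hK : B * ENNReal.ofReal C' ^ size η ≠ ∞ :=
      ENNReal.mul_ne_top ENNReal.coe_ne_top (ENNReal.pow_ne_top ENNReal.ofReal_ne_top)
    have hle : ∀ x ∈ sel η,
        ∫⁻ ξ, ‖g (ξ.1 ∪ η.1, ξ.2 ∪ η.2) * (∫ x', D η x ξ x')‖ₑ ∂lambda2 d ≤
        B * ENNReal.ofReal C' ^ size η * normOfIntegral C (fun x' ξ => D η x ξ x') := by
      intro x hx
      unfold normOfIntegral
      rw [← lintegral_const_mul' _ _ hK]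
      refine lintegral_mono_ae ?_
      filter_upwards [hint x hx, ae_size_pairUnion η] with ξ hξ hsz
      rw [if_pos hξ, enorm_mul]
      calc ‖g (ξ.1 ∪ η.1, ξ.2 ∪ η.2)‖ₑ * ‖∫ x', D η x ξ x'‖ₑ
          ≤ (B * ENNReal.ofReal C' ^ (size η + size ξ)) * ‖∫ x', D η x ξ x'‖ₑ := by
            gcongr
            exact hsz ▸ hB _
        _ = (B * ENNReal.ofReal C' ^ size η) *
            (‖∫ x', D η x ξ x'‖ₑ * ENNReal.ofReal C' ^ size ξ) := by ring
        _ ≤ _ := by gcongr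
    refine ⟨fun x hx => ⟨hint x hx, ?_, ?_⟩,
      sum_bound fun x hx => (enorm_integral_le_lintegral_enorm _).trans (hle x hx)⟩
    · have h1 : Measurable fun ξ : Pair d => g (ξ.1 ∪ η.1, ξ.2 ∪ η.2) :=
        hg.comp (measurable_pairUnion.comp (measurable_prodMk_right (y := η)))
      exact (h1.mul
        (hDm x).stronglyMeasurable.integral_prod_right'.measurable).aestronglyMeasurable
    · exact (hle x hx).trans_lt (ENNReal.mul_lt_top hK.lt_top (hfin x hx).lt_top)
  measurable g hg := by
    refine hsel (fun x η => ∫ ξ, g (ξ.1 ∪ η.1, ξ.2 ∪ η.2) * (∫ x', D η x ξ x') ∂lambda2 d) ?_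
    have h0 : StronglyMeasurable fun p : ((Pair d × Site d) × Pair d) × Site d =>
        D p.1.1.1 p.1.1.2 p.1.2 p.2 :=
      (Measurable.comp hD MeasurableEquiv.prodAssoc.measurable).stronglyMeasurable
    have m : Measurable fun p : (Pair d × Site d) × Pair d => (p.2, p.1.1) := by fun_prop
    have h1 := hg.comp (measurable_pairUnion.comp m)
    have h2 := h1.mul (h0.integral_prod_right' (ν := volume)).measurable
    exact h2.stronglyMeasurable.integral_prod_right'.measurable

end Terms

/-! ### The jumps -/

/-- Off a null set of `ξ` and `x'`, the removal of `x` can be moved onto `η`. A jump is then a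
removal, a union and an insertion, each of which is known to respect null sets. -/
lemma jump_eq {ξ η : Conf d} {x x' : Site d} (hξ : x ∉ ξ.points) (hx : x' ≠ x) :
    (ξ ∪ η ∪ {x'}) \ {x} = ξ ∪ (η \ {x}) ∪ {x'} := by
  ext a
  simp only [sdiff_points, union_points, singleton_points, Finset.mem_sdiff, Finset.mem_union,
    Finset.mem_singleton]
  constructor
  · tauto
  · rintro ((h | h) | rfl)
    · exact ⟨Or.inl (Or.inl h), fun he => hξ (he ▸ h)⟩
    · tauto
    · tauto

lemma remove_union_eq {ξ η : Conf d} {x : Site d} (hξ : x ∉ ξ.points) :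
    (ξ ∪ η) \ {x} = ξ ∪ (η \ {x}) := by
  ext a
  simp only [sdiff_points, union_points, singleton_points, Finset.mem_sdiff, Finset.mem_union,
    Finset.mem_singleton]
  constructor
  · tauto
  · rintro (h | h)
    · exact ⟨Or.inl h, fun he => hξ (he ▸ h)⟩
    · tauto

lemma card_union {ξ η : Conf d} (h : Disjoint ξ.points η.points) :
    (ξ ∪ η).points.card = ξ.points.card + η.points.card := by
  rw [union_points, Finset.card_union_of_disjoint h]

lemma card_insert {η : Conf d} {x : Site d} (h : x ∉ η.points) :
    (η ∪ {x}).points.card = η.points.card + 1 := by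
  rw [union_points, singleton_points, Finset.card_union_of_disjoint
    (Finset.disjoint_singleton_right.2 h), Finset.card_singleton]

lemma card_remove {η : Conf d} {x : Site d} (h : x ∈ η.points) :
    (η \ {x}).points.card + 1 = η.points.card := by
  rw [sdiff_points, singleton_points, Finset.sdiff_singleton_eq_erase,
    Finset.card_erase_add_one h]

section Jumps

variable [NeZero d]

lemma ae_notMem_finset (S : Finset (Site d)) : ∀ᵐ x : Site d, x ∉ S :=
  measure_eq_zero_iff_ae_notMem.1 (S.finite_toSet.measure_zero volume)

lemma ae_pair_notMem (x : Site d) : ∀ᵐ ξ ∂lambda2 d, x ∉ ξ.1.points ∧ x ∉ ξ.2.points := by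
  rw [lambda2_eq]
  filter_upwards [Measure.quasiMeasurePreserving_fst.ae (ae_notMem x),
    Measure.quasiMeasurePreserving_snd.ae (ae_notMem x)] with ξ h1 h2
  exact ⟨h1, h2⟩

lemma ae_pair_disjoint (η : Pair d) : ∀ᵐ ξ ∂lambda2 d,
    Disjoint ξ.1.points η.1.points ∧ Disjoint ξ.2.points η.2.points := by
  rw [lambda2_eq]
  filter_upwards [Measure.quasiMeasurePreserving_fst.ae (ae_disjoint η.1),
    Measure.quasiMeasurePreserving_snd.ae (ae_disjoint η.2)] with ξ h1 h2
  exact ⟨h1, h2⟩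

lemma isJump_plus_plus : IsJump (d := d) (fun η => η.1.points)
    (fun η x ξ x' => ((ξ.1 ∪ η.1 ∪ {x'}) \ {x}, ξ.2 ∪ η.2)) where
  measurable := by
    have m1 : Measurable fun p : (Pair d × Site d) × Pair d × Site d => (p.2.1, p.1.1) := by
      fun_prop
    have m2 := measurable_pairUnion.comp m1
    have m3 : Measurable fun p : (Pair d × Site d) × Pair d × Site d => p.2.2 := by fun_prop
    have m4 := measurable_insertPlus.comp (m2.prodMk m3)
    have m5 : Measurable fun p : (Pair d × Site d) × Pair d × Site d => p.1.2 := by fun_prop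
    exact measurable_removePlus.comp (m4.prodMk m5)
  ae P h := by
    -- The operations are nested inside out: the last insertion is treated first and the removal
    -- from `η` last.
    filter_upwards [ae_removePlus (ae_ae_pairUnion (ae_ae_insertPlus h))] with η hη x hx
    filter_upwards [hη x hx, ae_pair_notMem x] with ξ hξ hxξ
    filter_upwards [hξ, Measure.ae_ne volume x] with x' hx' hne
    rw [jump_eq hxξ.1 hne]
    exact hx'
  size_eq η x hx := by
    filter_upwards [ae_pair_disjoint η] with ξ hξ
    filter_upwards [ae_notMem_finset (ξ.1 ∪ η.1).points] with x' hx'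
    have h1 := card_union hξ.1
    have h2 := card_union hξ.2
    have h3 := card_insert hx'
    have h4 := card_remove (η := ξ.1 ∪ η.1 ∪ {x'}) (x := x) (by simp [hx])
    simp only [size]
    omega

lemma isJump_minus_minus : IsJump (d := d) (fun η => η.2.points)
    (fun η x ξ x' => (ξ.1 ∪ η.1, (ξ.2 ∪ η.2 ∪ {x'}) \ {x})) where
  measurable := by
    have m1 : Measurable fun p : (Pair d × Site d) × Pair d × Site d => (p.2.1, p.1.1) := by
      fun_prop
    have m2 := measurable_pairUnion.comp m1
    have m3 : Measurable fun p : (Pair d × Site d) × Pair d × Site d => p.2.2 := by fun_prop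
    have m4 := measurable_insertMinus.comp (m2.prodMk m3)
    have m5 : Measurable fun p : (Pair d × Site d) × Pair d × Site d => p.1.2 := by fun_prop
    exact measurable_removeMinus.comp (m4.prodMk m5)
  ae P h := by
    filter_upwards [ae_removeMinus (ae_ae_pairUnion (ae_ae_insertMinus h))] with η hη x hx
    filter_upwards [hη x hx, ae_pair_notMem x] with ξ hξ hxξ
    filter_upwards [hξ, Measure.ae_ne volume x] with x' hx' hne
    rw [jump_eq hxξ.2 hne]
    exact hx'
  size_eq η x hx := by
    filter_upwards [ae_pair_disjoint η] with ξ hξ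
    filter_upwards [ae_notMem_finset (ξ.2 ∪ η.2).points] with x' hx'
    have h1 := card_union hξ.1
    have h2 := card_union hξ.2
    have h3 := card_insert hx'
    have h4 := card_remove (η := ξ.2 ∪ η.2 ∪ {x'}) (x := x) (by simp [hx])
    simp only [size]
    omega

lemma isJump_minus_plus : IsJump (d := d) (fun η => η.2.points)
    (fun η x ξ x' => (ξ.1 ∪ η.1 ∪ {x'}, (ξ.2 ∪ η.2) \ {x})) where
  measurable := by
    have m1 : Measurable fun p : (Pair d × Site d) × Pair d × Site d => (p.2.1, p.1.1) := by
      fun_prop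
    have m2 := measurable_pairUnion.comp m1
    have m3 : Measurable fun p : (Pair d × Site d) × Pair d × Site d => p.2.2 := by fun_prop
    have m4 := measurable_insertPlus.comp (m2.prodMk m3)
    have m5 : Measurable fun p : (Pair d × Site d) × Pair d × Site d => p.1.2 := by fun_prop
    exact measurable_removeMinus.comp (m4.prodMk m5)
  ae P h := by
    filter_upwards [ae_removeMinus (ae_ae_pairUnion (ae_ae_insertPlus h))] with η hη x hx
    filter_upwards [hη x hx, ae_pair_notMem x] with ξ hξ hxξ
    -- The new point enters the other component, so `x' ≠ x` is not required.
    filter_upwards [hξ] with x' hx'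
    rw [remove_union_eq hxξ.2]
    exact hx'
  size_eq η x hx := by
    filter_upwards [ae_pair_disjoint η] with ξ hξ
    filter_upwards [ae_notMem_finset (ξ.1 ∪ η.1).points] with x' hx'
    have h1 := card_union hξ.1
    have h2 := card_union hξ.2
    have h3 := card_insert hx'
    have h4 := card_remove (η := ξ.2 ∪ η.2) (x := x) (by simp [hx])
    simp only [size]
    omega

lemma isJump_plus_minus : IsJump (d := d) (fun η => η.1.points)
    (fun η x ξ x' => ((ξ.1 ∪ η.1) \ {x}, ξ.2 ∪ η.2 ∪ {x'})) where
  measurable := by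
    have m1 : Measurable fun p : (Pair d × Site d) × Pair d × Site d => (p.2.1, p.1.1) := by
      fun_prop
    have m2 := measurable_pairUnion.comp m1
    have m3 : Measurable fun p : (Pair d × Site d) × Pair d × Site d => p.2.2 := by fun_prop
    have m4 := measurable_insertMinus.comp (m2.prodMk m3)
    have m5 : Measurable fun p : (Pair d × Site d) × Pair d × Site d => p.1.2 := by fun_prop
    exact measurable_removePlus.comp (m4.prodMk m5)
  ae P h := by
    filter_upwards [ae_removePlus (ae_ae_pairUnion (ae_ae_insertMinus h))] with η hη x hx
    filter_upwards [hη x hx, ae_pair_notMem x] with ξ hξ hxξ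
    filter_upwards [hξ] with x' hx'
    rw [remove_union_eq hxξ.1]
    exact hx'
  size_eq η x hx := by
    filter_upwards [ae_pair_disjoint η] with ξ hξ
    filter_upwards [ae_notMem_finset (ξ.2 ∪ η.2).points] with x' hx'
    have h1 := card_union hξ.1
    have h2 := card_union hξ.2
    have h3 := card_insert hx'
    have h4 := card_remove (η := ξ.1 ∪ η.1) (x := x) (by simp [hx])
    simp only [size]
    omega

end Jumps

/-! ### The spaces `𝒦_C` -/

lemma enorm_mul_inv_pow_le_iff {C : ℝ} (hC : 0 < C) (a : ℝ) (n : ℕ) (B : ℝ≥0) :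
    ‖a * (C ^ n)⁻¹‖ₑ ≤ B ↔ ‖a‖ₑ ≤ B * ENNReal.ofReal C ^ n := by
  have hp : ‖(C ^ n)⁻¹‖ₑ = (ENNReal.ofReal C ^ n)⁻¹ := by
    rw [Real.enorm_eq_ofReal (by positivity), ENNReal.ofReal_inv_of_pos (by positivity),
      ENNReal.ofReal_pow hC.le]
  rw [enorm_mul, hp, ← div_eq_mul_inv, ENNReal.div_le_iff]
  · exact pow_ne_zero _ (by simp [hC])
  · exact ENNReal.pow_ne_top ENNReal.ofReal_ne_top

lemma mem_KSpace_iff {C : ℝ} (hC : 0 < C) (k : Pair d →ₘ[lambda2 d] ℝ) :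
    k ∈ KSpace d C ↔
      ∃ B : ℝ≥0, ∀ᵐ η ∂lambda2 d, ‖k η‖ₑ ≤ B * ENNReal.ofReal C ^ size η := by
  change MemLp (fun η => k η * (C ^ size η)⁻¹) ∞ (lambda2 d) ↔ _
  have hm : AEStronglyMeasurable (fun η => k η * (C ^ size η)⁻¹) (lambda2 d) :=
    k.aestronglyMeasurable.mul ((measurable_of_countable (fun n : ℕ => (C ^ n)⁻¹)).comp
      measurable_size).aestronglyMeasurable
  constructor
  · intro h
    have hlt := h.2
    rw [eLpNorm_exponent_top] at hlt
    refine ⟨(eLpNormEssSup (fun η => k η * (C ^ size η)⁻¹) (lambda2 d)).toNNReal, ?_⟩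
    filter_upwards [enorm_ae_le_eLpNormEssSup (fun η => k η * (C ^ size η)⁻¹) (lambda2 d)]
      with η hη
    rw [← enorm_mul_inv_pow_le_iff hC, ENNReal.coe_toNNReal hlt.ne]
    exact hη
  · rintro ⟨B, hB⟩
    refine memLp_top_of_bound hm B ?_
    filter_upwards [hB] with η hη
    rw [← enorm_mul_inv_pow_le_iff hC] at hη
    rw [← coe_nnnorm]
    exact_mod_cast hη

lemma KSpace_mono {C C' : ℝ} (hC' : 0 < C') (h : C' ≤ C) : KSpace d C' ≤ KSpace d C := by
  intro k hk
  rw [mem_KSpace_iff hC'] at hk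
  rw [mem_KSpace_iff (hC'.trans_le h)]
  obtain ⟨B, hB⟩ := hk
  refine ⟨B, hB.mono fun η hη => hη.trans ?_⟩
  gcongr

/-- Setting the function to zero where the bound fails makes the bound hold everywhere, as
`IsTerm.bound` requires. -/
lemma exists_bounded_representative {C : ℝ} (hC : 0 < C) {k : Pair d →ₘ[lambda2 d] ℝ}
    (hk : k ∈ KSpace d C) : ∃ g : Pair d → ℝ, Measurable g ∧ k =ᵐ[lambda2 d] g ∧
      ∃ B : ℝ≥0, ∀ ζ, ‖g ζ‖ₑ ≤ B * ENNReal.ofReal C ^ size ζ := by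
  obtain ⟨B, hB⟩ := (mem_KSpace_iff hC k).1 hk
  have hm : Measurable k := k.stronglyMeasurable.measurable
  have hs : Measurable fun ζ : Pair d => (B : ℝ≥0∞) * ENNReal.ofReal C ^ size ζ :=
    measurable_const.mul ((measurable_of_countable (fun n : ℕ => ENNReal.ofReal C ^ n)).comp
      measurable_size)
  refine ⟨fun ζ => if ‖k ζ‖ₑ ≤ B * ENNReal.ofReal C ^ size ζ then k ζ else 0,
    Measurable.ite (measurableSet_le hm.enorm hs) hm measurable_const, ?_, B, fun ζ => ?_⟩
  · filter_upwards [hB] with ζ hζ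
    rw [if_pos hζ]
  · dsimp only
    split_ifs with h
    · exact h
    · simp

lemma exists_pow_mul_bound (M : ℕ) {r : ℝ} (h0 : 0 < r) (h1 : r < 1) :
    ∃ S : ℝ, 0 ≤ S ∧ ∀ n : ℕ, (1 + (n : ℝ)) ^ M * r ^ n ≤ S := by
  have ht := tendsto_pow_const_mul_const_pow_of_abs_lt_one M (r := r) (by rwa [abs_of_pos h0])
  obtain ⟨S, hS⟩ := ht.bddAbove_range
  have hS' : ∀ n : ℕ, (n : ℝ) ^ M * r ^ n ≤ S := fun n => hS ⟨n, rfl⟩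
  have hS1 : 0 ≤ S := le_trans (by positivity) (hS' 1)
  refine ⟨S / r, by positivity, fun n => ?_⟩
  rw [le_div_iff₀ h0]
  -- Boundedness of `n^M r^n` at index `n + 1` gives the shifted power `(1 + n)^M` at the cost of
  -- one factor `r`; hence the constant `S / r`.
  have := hS' (n + 1)
  push_cast at this
  rw [add_comm 1, mul_assoc, ← pow_succ]
  exact this

/-! ### The operator defined by a term -/

section Operator

variable {C α ν A : ℝ} {M : ℕ} {b : Pair d → ℝ≥0∞} {w : (Pair d → ℝ) → Pair d → Prop}
  {t : (Pair d → ℝ) → Pair d → ℝ} {N : Pair d → ℝ}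

lemma IsTerm.wellDefined {C' : ℝ} (ht : IsTerm C' b w t) (hC' : 0 < C')
    (hb : ∀ᵐ η ∂lambda2 d, b η ≤ ENNReal.ofReal (N η)) {k : Pair d →ₘ[lambda2 d] ℝ}
    (hk : k ∈ KSpace d C') {f : Pair d → ℝ} (hf : f =ᵐ[lambda2 d] k) :
    ∀ᵐ η ∂lambda2 d, w f η := by
  obtain ⟨g, hg, hkg, B, hB⟩ := exists_bounded_representative hC' hk
  filter_upwards [hb, ht.congr g f (hf.trans hkg).symm] with η h1 h2
  exact h2.1 (ht.bound g hg B hB η (ne_top_of_le_ne_top ENNReal.ofReal_ne_top h1)).1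

lemma IsTerm.aestronglyMeasurable {C' : ℝ} (ht : IsTerm C' b w t) (k : Pair d →ₘ[lambda2 d] ℝ) :
    AEStronglyMeasurable (t k) (lambda2 d) :=
  (ht.measurable k k.stronglyMeasurable.measurable).aestronglyMeasurable

/-- The polynomial factor is absorbed by `(αν)^{|η|}`, since `αν < 1`. The resulting bound on the
image is `B A S`, where `S` bounds `(1 + n)^M (αν)^n`. -/
lemma IsTerm.mem_KSpace (ht : IsTerm (α * C) b w t) (hC : 0 < C) (hα : 0 < α) (hν : 1 ≤ ν)
    (hα' : α < 1 / ν) (hA : 0 < A) (hb : ∀ᵐ η ∂lambda2 d, b η ≤ ENNReal.ofReal (N η))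
    (hN : GrowthBound A M ν N) {k : Pair d →ₘ[lambda2 d] ℝ} (hk : k ∈ KSpace d (α * C)) :
    AEEqFun.mk (t k) (ht.aestronglyMeasurable k) ∈ KSpace d C := by
  have hν0 : 0 < ν := by linarith
  have hC' : 0 < α * C := by positivity
  obtain ⟨g, hg, hkg, B, hB⟩ := exists_bounded_representative hC' hk
  obtain ⟨S, hS0, hS⟩ := exists_pow_mul_bound M (mul_pos hα hν0) ((lt_div_iff₀ hν0).1 hα')
  rw [mem_KSpace_iff hC]
  refine ⟨B * (A * S).toNNReal, ?_⟩
  filter_upwards [hb, ht.congr _ _ hkg, ae_mem_Conf2,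
    AEEqFun.coeFn_mk (t k) (ht.aestronglyMeasurable k)] with η h1 h2 h3 h4
  rw [h4, h2.2]
  refine (ht.bound g hg B hB η (ne_top_of_le_ne_top ENNReal.ofReal_ne_top h1)).2.trans ?_
  have h5 : b η ≤ ENNReal.ofReal (A * (1 + (size η : ℝ)) ^ M * ν ^ size η) :=
    h1.trans (ENNReal.ofReal_le_ofReal (hN η h3))
  have h6 : ENNReal.ofReal (α * C) ^ size η *
      ENNReal.ofReal (A * (1 + (size η : ℝ)) ^ M * ν ^ size η) ≤
        ENNReal.ofReal (A * S) * ENNReal.ofReal C ^ size η := by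
    rw [← ENNReal.ofReal_pow hC'.le, ← ENNReal.ofReal_pow hC.le,
      ← ENNReal.ofReal_mul (by positivity), ← ENNReal.ofReal_mul (by positivity)]
    refine ENNReal.ofReal_le_ofReal ?_
    calc (α * C) ^ size η * (A * (1 + (size η : ℝ)) ^ M * ν ^ size η)
        = A * C ^ size η * ((1 + (size η : ℝ)) ^ M * (α * ν) ^ size η) := by
          rw [mul_pow, mul_pow]; ring
      _ ≤ A * C ^ size η * S := by
          gcongr
          exact hS _
      _ = A * S * C ^ size η := by ring
  calc (B : ℝ≥0∞) * ENNReal.ofReal (α * C) ^ size η * b η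
      ≤ B * (ENNReal.ofReal (α * C) ^ size η *
        ENNReal.ofReal (A * (1 + (size η : ℝ)) ^ M * ν ^ size η)) := by
        rw [mul_assoc]
        gcongr
    _ ≤ B * (ENNReal.ofReal (A * S) * ENNReal.ofReal C ^ size η) := by gcongr
    _ = _ := by
        rw [ENNReal.coe_mul, mul_assoc]
        rfl

/-- A term that is bounded by a function of controlled growth defines an operator. -/
theorem IsTerm.exists_operator (ht : IsTerm (α * C) b w t) (hC : 0 < C) (hα : 0 < α)
    (hν : 1 ≤ ν) (hα' : α < 1 / ν) (hA : 0 < A)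
    (hb : ∀ᵐ η ∂lambda2 d, b η ≤ ENNReal.ofReal (N η)) (hN : GrowthBound A M ν N)
    {W : (Pair d → ℝ) → Pair d → Prop} {E : (Pair d → ℝ) → Pair d → ℝ}
    (hW : ∀ k η, w k η → W k η) (hE : ∀ k η, E k η = t k η) :
    ∃ L : KSpace d C →ₗ.[ℝ] KSpace d C, IsOperatorGivenBy C (α * C) W E L := by
  have hC' : 0 < α * C := by positivity
  have hα1 : α ≤ 1 := hα'.le.trans ((div_le_one (by linarith)).2 hν)
  have hmono : KSpace d (α * C) ≤ KSpace d C :=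
    KSpace_mono hC' (mul_le_of_le_one_left hC.le hα1)
  let dom : Submodule ℝ (KSpace d C) := (KSpace d (α * C)).comap (KSpace d C).subtype
  let T : dom → KSpace d C := fun k =>
    ⟨AEEqFun.mk (t ((k : KSpace d C) : Pair d →ₘ[lambda2 d] ℝ)) (ht.aestronglyMeasurable _),
      ht.mem_KSpace hC hα hν hα' hA hb hN k.2⟩
  have hT : ∀ k : dom, (T k : Pair d →ₘ[lambda2 d] ℝ) =ᵐ[lambda2 d]
      t ((k : KSpace d C) : Pair d →ₘ[lambda2 d] ℝ) := fun k => AEEqFun.coeFn_mk _ _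
  have hw : ∀ k : dom, ∀ᵐ η ∂lambda2 d, w ((k : KSpace d C) : Pair d →ₘ[lambda2 d] ℝ) η :=
    fun k => ht.wellDefined hC' hb k.2 Filter.EventuallyEq.rfl
  let L : KSpace d C →ₗ.[ℝ] KSpace d C :=
    { domain := dom
      toFun :=
        { toFun := T
          map_add' := by
            intro k l
            -- The chosen representative of `k + l` agrees only a.e. with the sum of those of `k`
            -- and `l`, so `congr` is applied first; `add` then applies where both terms are
            -- well-defined.
            refine Subtype.ext (AEEqFun.ext ?_)
            filter_upwards [hT (k + l), hT k, hT l, hw k, hw l,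
              ht.congr _ _ (AEEqFun.coeFn_add ((k : KSpace d C) : Pair d →ₘ[lambda2 d] ℝ)
                ((l : KSpace d C) : Pair d →ₘ[lambda2 d] ℝ)),
              AEEqFun.coeFn_add (T k : Pair d →ₘ[lambda2 d] ℝ) (T l : Pair d →ₘ[lambda2 d] ℝ)]
              with η h1 h2 h3 h4 h5 h6 h7
            change _ = ((T k : Pair d →ₘ[lambda2 d] ℝ) + (T l : Pair d →ₘ[lambda2 d] ℝ)) η
            rw [h7, Pi.add_apply, h1, h2, h3, ← ht.add _ _ η h4 h5]
            exact h6.2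
          map_smul' := by
            intro a k
            refine Subtype.ext (AEEqFun.ext ?_)
            filter_upwards [hT (a • k), hT k,
              ht.congr _ _ (AEEqFun.coeFn_smul a ((k : KSpace d C) : Pair d →ₘ[lambda2 d] ℝ)),
              AEEqFun.coeFn_smul a (T k : Pair d →ₘ[lambda2 d] ℝ)] with η h1 h2 h3 h4
            change _ = (a • (T k : Pair d →ₘ[lambda2 d] ℝ)) η
            rw [h4, Pi.smul_apply, h1, h2, smul_eq_mul, ← ht.smul]
            exact h3.2 } }
  refine ⟨L, ?_, fun k f hf => ⟨?_, ?_⟩⟩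
  · change dom.map (KSpace d C).subtype = _
    rw [Submodule.map_comap_subtype]
    exact inf_eq_right.2 hmono
  · exact (ht.wellDefined hC' hb k.2 hf).mono fun η hη => hW f η hη
  · filter_upwards [hT k, ht.congr _ _ hf] with η h1 h2
    change (T k : Pair d →ₘ[lambda2 d] ℝ) η = _
    rw [h1, hE, h2.2]

end Operator

/-! ### The dual generators -/

lemma measurable_coeff_comp {c : Rate d} (hc : IsRate c) {rem : Pair d → Site d → Pair d}
    (hr : Measurable fun p : Pair d × Site d => rem p.1 p.2) :
    Measurable fun p : (Pair d × Site d) × Pair d × Site d =>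
      coeff c p.1.2 p.2.2 (rem p.1.1 p.1.2) p.2.1 := by
  have m0 : Measurable fun p : (Pair d × Site d) × Pair d × Site d => p.1 := by fun_prop
  have m1 := hr.comp m0
  have m2 : Measurable fun p : (Pair d × Site d) × Pair d × Site d => (p.1.2, p.2.2) := by fun_prop
  have m3 : Measurable fun p : (Pair d × Site d) × Pair d × Site d => p.2.1 := by fun_prop
  have h := Measurable.comp (measurable_coeff hc) (m2.prodMk (m1.prodMk m3))
  exact h

lemma measurable_coeff_comp_swap {c : Rate d} (hc : IsRate c) {rem : Pair d → Site d → Pair d}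
    (hr : Measurable fun p : Pair d × Site d => rem p.1 p.2) :
    Measurable fun p : (Pair d × Site d) × Pair d × Site d =>
      coeff c p.2.2 p.1.2 (rem p.1.1 p.1.2) p.2.1 := by
  have m0 : Measurable fun p : (Pair d × Site d) × Pair d × Site d => p.1 := by fun_prop
  have m1 := hr.comp m0
  have m2 : Measurable fun p : (Pair d × Site d) × Pair d × Site d => (p.2.2, p.1.2) := by fun_prop
  have m3 : Measurable fun p : (Pair d × Site d) × Pair d × Site d => p.2.1 := by fun_prop
  have h := Measurable.comp (measurable_coeff hc) (m2.prodMk (m1.prodMk m3))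
  exact h

/-- The last term of `dualL2` has `k` under the inner integral, although `bound2` controls it by
`normOfIntegral`. As `k` is constant in the inner variable there, the weighted form suffices. -/
lemma WeightedIntegrable.iteratedIntegrable {g : Pair d → ℝ} {F : Pair d → Site d → ℝ}
    (h : WeightedIntegrable g F) : IteratedIntegrable fun ξ x => g ξ * F ξ x := by
  refine ⟨h.1.mono fun ξ hξ => hξ.const_mul _, ?_⟩
  simp only [integral_const_mul]
  exact h.2

section Generators

variable [NeZero d] {C C' : ℝ} {cp cm : Rate d}

lemma isTerm_dualL1 (hC : 0 < C) (hCC : C' ≤ C) (hp : IsRate cp) (hm : IsRate cm) :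
    ∃ w t, IsTerm C' (bound1 C cp cm) w t ∧ (∀ k η, w k η → WellDefined1 cp cm k η) ∧
      ∀ k η, dualL1 cp cm k η = t k η := by
  have h1 := isTerm_iterated (D := fun η x ξ x' => coeff cp x' x (removePlus η x) ξ)
    hCC isSide_plus isJump_plus_plus (measurable_coeff_comp_swap hp measurable_removePlus)
  have h2 := isTerm_weighted (D := fun η x ξ x' => coeff cp x x' (removePlus η x) ξ)
    hC hCC isSide_plus (measurable_coeff_comp hp measurable_removePlus)
  have h3 := isTerm_iterated (D := fun η x ξ x' => coeff cm x' x (removeMinus η x) ξ)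
    hCC isSide_minus isJump_minus_minus (measurable_coeff_comp_swap hm measurable_removeMinus)
  have h4 := isTerm_weighted (D := fun η x ξ x' => coeff cm x x' (removeMinus η x) ξ)
    hC hCC isSide_minus (measurable_coeff_comp hm measurable_removeMinus)
  refine ⟨_, _, (((h1.sum h2.neg).sum h3).sum h4.neg).mono_bound fun η => le_of_eq ?_, ?_, ?_⟩
  -- The four bounds add up exactly to the hypothesis: gain terms use the integrals of norms, loss
  -- terms the norms of integrals.
  · simp only [bound1, Finset.sum_add_distrib]
    ring
  · rintro k η ⟨⟨⟨w1, w2⟩, w3⟩, w4⟩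
    exact ⟨fun x hx => ⟨w1 x hx, w2 x hx⟩, fun y hy => ⟨w3 y hy, w4 y hy⟩⟩
  · intro k η
    simp only [dualL1, sub_eq_add_neg]

lemma isTerm_dualL2 (hC : 0 < C) (hCC : C' ≤ C) (hp : IsRate cp) (hm : IsRate cm) :
    ∃ w t, IsTerm C' (bound2 C cp cm) w t ∧ (∀ k η, w k η → WellDefined2 cp cm k η) ∧
      ∀ k η, dualL2 cp cm k η = t k η := by
  have h1 := isTerm_iterated (D := fun η x ξ x' => coeff cp x' x (removeMinus η x) ξ)
    hCC isSide_minus isJump_minus_plus (measurable_coeff_comp_swap hp measurable_removeMinus)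
  have h2 := isTerm_weighted (D := fun η x ξ x' => coeff cp x x' (removePlus η x) ξ)
    hC hCC isSide_plus (measurable_coeff_comp hp measurable_removePlus)
  have h3 := isTerm_iterated (D := fun η x ξ x' => coeff cm x x' (removePlus η x) ξ)
    hCC isSide_plus isJump_plus_minus (measurable_coeff_comp hm measurable_removePlus)
  have h4 := isTerm_weighted (D := fun η x ξ x' => coeff cm x' x (removeMinus η x) ξ)
    hC hCC isSide_minus (measurable_coeff_comp_swap hm measurable_removeMinus)
  refine ⟨_, _, (((h1.sum h2.neg).sum h3).sum h4.neg).mono_bound fun η => le_of_eq ?_, ?_, ?_⟩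
  · simp only [bound2, Finset.sum_add_distrib]
    ring
  · rintro k η ⟨⟨⟨w1, w2⟩, w3⟩, w4⟩
    exact ⟨fun y hy => ⟨w1 y hy, (w4 y hy).iteratedIntegrable⟩,
      fun x hx => ⟨w2 x hx, w3 x hx⟩⟩
  · intro k η
    simp only [dualL2, sub_eq_add_neg, integral_const_mul]

end Generators

end Hopping

theorem mainTheorem8 (d : ℕ) (hd : 1 ≤ d) (C : ℝ) (hC : 0 < C)
    (c₁p c₁m c₂p c₂m : Hopping.Rate d)
    (hc₁p : Hopping.IsRate c₁p) (hc₁m : Hopping.IsRate c₁m)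
    (hc₂p : Hopping.IsRate c₂p) (hc₂m : Hopping.IsRate c₂m)
    (N₁ N₂ : Hopping.Pair d → ℝ)
    (hN₁ : Hopping.LocallyIntegrableN N₁) (hN₂ : Hopping.LocallyIntegrableN N₂)
    (hb₁ : ∀ᵐ η ∂(Hopping.lambda2 d), Hopping.bound1 C c₁p c₁m η ≤ ENNReal.ofReal (N₁ η))
    (hb₂ : ∀ᵐ η ∂(Hopping.lambda2 d), Hopping.bound2 C c₂p c₂m η ≤ ENNReal.ofReal (N₂ η))
    (A : ℝ) (hA : 0 < A) (M : ℕ) (ν : ℝ) (hν : 1 ≤ ν)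
    (hg₁ : Hopping.GrowthBound A M ν N₁) (hg₂ : Hopping.GrowthBound A M ν N₂)
    (α : ℝ) (hα : 0 < α) (hα' : α < 1 / ν) :
    (∃ L₁ : Hopping.KSpace d C →ₗ.[ℝ] Hopping.KSpace d C,
      Hopping.IsOperatorGivenBy C (α * C) (Hopping.WellDefined1 c₁p c₁m)
        (Hopping.dualL1 c₁p c₁m) L₁) ∧
    (∃ L₂ : Hopping.KSpace d C →ₗ.[ℝ] Hopping.KSpace d C,
      Hopping.IsOperatorGivenBy C (α * C) (Hopping.WellDefined2 c₂p c₂m)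
        (Hopping.dualL2 c₂p c₂m) L₂) := by
  have : NeZero d := ⟨by omega⟩
  have hα1 : α ≤ 1 := hα'.le.trans ((div_le_one (by linarith)).2 hν)
  have hCC : α * C ≤ C := mul_le_of_le_one_left hC.le hα1
  obtain ⟨w₁, t₁, ht₁, hw₁, he₁⟩ := Hopping.isTerm_dualL1 hC hCC hc₁p hc₁m
  obtain ⟨w₂, t₂, ht₂, hw₂, he₂⟩ := Hopping.isTerm_dualL2 hC hCC hc₂p hc₂m
  exact ⟨ht₁.exists_operator hC hα hν hα' hA hb₁ hg₁ hw₁ he₁,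
    ht₂.exists_operator hC hα hν hα' hA hb₂ hg₂ hw₂ he₂⟩
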